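/- Let $\mathbb T^2=\mathbb R^2/\mathbb Z^2$ be the flat torus, $T^1\mathbb T^2=\mathbb T^2\times S^1$ its unit tangent bundle, and $\varphi_t(p,v)=(p+tv,v)$ its geodesic flow. Let $\mathrm{Haar}$ be the product of the normalized Haar measures of $\mathbb T^2$ and $S^1$. Definitions. A scale is a family of positive nondecreasing functions $a_\chi$ of positive time, $\chi\ge 0$, with $a_\chi=o(a_{\chi'})$ for $\chi<\chi'$; the polynomial scale is $p_\chi(n)=n^\chi$. For a transformation $f$ of a metric space and a compact set $K$, let $N_{f,K}(\epsilon,n)$ be the minimal number of sets $\{y:\max_{0\le i<n}d(f^ix,f^iy)<\epsilon\}$ that cover $K$, and $$h_{\mathrm{top},a}(f)=\sup_K\lim_{\epsilon\to0}\sup\Big\{\chi:\limsup_{n\to\infty}\frac{N_{f,K}(\epsilon,n)}{a_\chi(n)}>0\Big\}\qquad(\sup\emptyset=0).$$ For an $f$-invariant probability measure $\mu$ and a finite measurable partition $\mathcal P$, let $\bar d^n_{f,\mathcal P}(x,y)$ be the proportion of the times $0\le s<n$ at which $f^sx$ and $f^sy$ lie in different atoms of $\mathcal P$, let $S_{f,\mathcal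 P}(\epsilon,n)$ be the minimal cardinality of a finite set $F$ with $\mu\big(\bigcup_{x\in F}\{y:\bar d^n_{f,\mathcal P}(x,y)<\epsilon\}\big)>1-\epsilon$, and $$h_{\mu,a}(f)=\sup_{\mathcal P}\lim_{\epsilon\to0}\sup\Big\{\chi:\limsup_{n\to\infty}\frac{S_{f,\mathcal P}(\epsilon,n)}{a_\chi(n)}>0\Big\}.$$ For a flow, both quantities are defined in the same way, with $n\in\mathbb Z_{>0}$ replaced by a real time $T>0$, the times $0\le i<n$ replaced by $t\in[0,T]$, and proportions of times taken with respect to Lebesgue measure on $[0,T]$. A measure-preserving transformation (flow) is Kronecker if it is measurably isomorphic to a translation (to the translations along a continuous one-parameter subgroup) of a compact abelian metrizable group with its normalized Haar measure. Theorem. 1. At the polynomial scale, $h_{\mathrm{top},p}=h_{\mathrm{Haar},p}=1$, both for the flow $\varphi$ and for each transformation $\varphi_s$, $s\ne0$. 2. For every ergodic invariant probability measure $\nu$ of the flow, $(\varphi,\nu)$ is Kronecker, and for every scale $a$ the slow entropy $h_{\nu,a}$ is $0$, both for the flow and for each $\varphi_s$, $s\in\mathbb R$. Likewise, for every $s\in\mathbb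 R$ and every ergodic invariant probability measure $\nu$ of the transformation $\varphi_s$, $(\varphi_s,\nu)$ is Kronecker, and $h_{\nu,a}(\varphi_s)=0$ for every scale $a$. 3. $\mathrm{Haar}=\int_{S^1}\nu_v\,dv$, where $\nu_v$ is the Haar measure of $\mathbb T^2\times\{v\}$, is an ergodic decomposition of $\mathrm{Haar}$ with respect to the flow, and with respect to each $\varphi_s$, $s\neq 0$: for almost every $v\in S^1$ the measure $\nu_v$ is invariant and ergodic. 4. Slow entropy is not additive: for every ergodic decomposition $\mathrm{Haar}=\int\nu\,dP(\nu)$ with respect to the flow one has $h_{\mathrm{Haar},p}\neq\int h_{\nu,p}\,dP(\nu)$ for the slow entropies of the flow, and the same holds for each transformation $\varphi_s$, $s\ne0$, and its ergodic decompositions. -/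

import Mathlib

open MeasureTheory Filter Topology Set
open scoped NNReal ENNReal

namespace SlowEntropy

/-! ### Scales -/

/-- A scale: a family of positive (weakly) increasing functions `a χ` of positive time, indexed
by `χ ≥ 0`, with `a χ = o(a χ')` whenever `χ < χ'`. The type of times `τ` is `ℕ` for
transformations and `ℝ` for flows; only the values at positive times matter. -/
structure IsScale {τ : Type*} [Preorder τ] [Zero τ] (a : ℝ≥0 → τ → ℝ) : Prop where
  pos : ∀ χ t, 0 < t → 0 < a χ t
  mono : ∀ χ, MonotoneOn (a χ) (Ioi 0)
  isLittleO : ∀ χ χ', χ < χ' → a χ =o[atTop] a χ'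

/-- The polynomial scale `a_χ(n) = n ^ χ` in discrete time. -/
noncomputable def polyScale (χ : ℝ≥0) (n : ℕ) : ℝ := (n : ℝ) ^ (χ : ℝ)

/-- The polynomial scale `a_χ(t) = t ^ χ` in continuous time. -/
noncomputable def polyScaleReal (χ : ℝ≥0) (t : ℝ) : ℝ := t ^ (χ : ℝ)

/-- `sup {χ ≥ 0 : limsup_{t → ∞} N(t) / a_χ(t) > 0}`, with the convention `sup ∅ = 0`. -/
noncomputable def growthRate {τ : Type*} [Preorder τ] (a : ℝ≥0 → τ → ℝ) (N : τ → ℝ≥0∞) :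
    ℝ≥0∞ :=
  ⨆ (χ : ℝ≥0) (_ : 0 < limsup (fun t => N t / ENNReal.ofReal (a χ t)) atTop), (χ : ℝ≥0∞)

/-! ### Slow entropy of a transformation -/

section Transformation

variable {X : Type*}

/-- The open Bowen ball: the points `y` with `max_{0 ≤ i ≤ n - 1} d(f^i x, f^i y) < ε`. -/
def bowenBall [MetricSpace X] (f : X → X) (n : ℕ) (ε : ℝ) (x : X) : Set X :=
  {y | ∀ i < n, dist (f^[i] x) (f^[i] y) < ε}

/-- The minimal number of `(ε, n)`-Bowen balls that cover `K`. -/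
noncomputable def bowenCovering [MetricSpace X] (f : X → X) (K : Set X) (ε : ℝ) (n : ℕ) :
    ℝ≥0∞ :=
  ⨅ (F : Finset X) (_ : K ⊆ ⋃ x ∈ F, bowenBall f n ε x), (F.card : ℝ≥0∞)

/-- The topological slow entropy of `f` at the scale `a`. The inner quantity is monotone in `ε`,
so that the limit as `ε → 0` exists; it is written as a `limsup` in `[0, ∞]`. -/
noncomputable def topSlowEntropy [MetricSpace X] (f : X → X) (a : ℝ≥0 → ℕ → ℝ) : ℝ≥0∞ :=
  ⨆ (K : Set X) (_ : IsCompact K),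
    limsup (fun ε : ℝ => growthRate a (bowenCovering f K ε)) (𝓝[>] 0)

open scoped Classical in
/-- The Hamming distance up to time `n` of the codings of `x` and `y` with respect to the
partition of `X` into the fibres of `P : X → Fin k`. -/
noncomputable def hammingDist (f : X → X) {k : ℕ} (P : X → Fin k) (n : ℕ) (x y : X) : ℝ :=
  1 - (((Finset.range n).filter fun s => P (f^[s] x) = P (f^[s] y)).card : ℝ) / n

/-- The minimal cardinality of a finite set whose `(ε, n)`-Hamming balls have a union of measure
larger than `1 - ε`. -/
noncomputable def hammingCovering [MeasurableSpace X] (f : X → X) (μ : Measure X) {k : ℕ}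
    (P : X → Fin k) (ε : ℝ) (n : ℕ) : ℝ≥0∞ :=
  ⨅ (F : Finset X) (_ : 1 - ε < μ.real (⋃ x ∈ F, {y | hammingDist f P n x y < ε})),
    (F.card : ℝ≥0∞)

/-- The metric slow entropy of `f` with respect to the probability measure `μ` at the scale `a`.
The supremum is over all finite measurable partitions, given by measurable maps to `Fin k`. -/
noncomputable def metricSlowEntropy [MeasurableSpace X] (f : X → X) (a : ℝ≥0 → ℕ → ℝ)
    (μ : Measure X) : ℝ≥0∞ :=
  ⨆ (k : ℕ) (P : X → Fin k) (_ : Measurable P),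
    limsup (fun ε : ℝ => growthRate a (hammingCovering f μ P ε)) (𝓝[>] 0)

end Transformation

/-! ### Slow entropy of a flow -/

section FlowEntropy

variable {X : Type*} [MetricSpace X]

/-- The Bowen ball of a flow: the points that stay `ε`-close to `x` during the times `[0, T]`. -/
def flowBowenBall (φ : Flow ℝ X) (T ε : ℝ) (x : X) : Set X :=
  {y | ∀ t ∈ Icc 0 T, dist (φ t x) (φ t y) < ε}

/-- The minimal number of `(ε, T)`-Bowen balls of the flow that cover `K`. -/
noncomputable def flowBowenCovering (φ : Flow ℝ X) (K : Set X) (ε T : ℝ) : ℝ≥0∞ :=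
  ⨅ (F : Finset X) (_ : K ⊆ ⋃ x ∈ F, flowBowenBall φ T ε x), (F.card : ℝ≥0∞)

/-- The topological slow entropy of a flow at the scale `a`. -/
noncomputable def flowTopSlowEntropy (φ : Flow ℝ X) (a : ℝ≥0 → ℝ → ℝ) : ℝ≥0∞ :=
  ⨆ (K : Set X) (_ : IsCompact K),
    limsup (fun ε : ℝ => growthRate a (flowBowenCovering φ K ε)) (𝓝[>] 0)

/-- The Hamming distance of a flow: the proportion of the times in `[0, T]` at which the orbits of
`x` and `y` lie in different atoms of the partition into the fibres of `P`. -/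
noncomputable def flowHammingDist (φ : Flow ℝ X) {k : ℕ} (P : X → Fin k) (T : ℝ) (x y : X) : ℝ :=
  1 - (volume : Measure ℝ).real {t | t ∈ Icc 0 T ∧ P (φ t x) = P (φ t y)} / T

/-- The minimal cardinality of a finite set whose `(ε, T)`-Hamming balls have a union of measure
larger than `1 - ε`. -/
noncomputable def flowHammingCovering [MeasurableSpace X] (φ : Flow ℝ X) (μ : Measure X) {k : ℕ}
    (P : X → Fin k) (ε T : ℝ) : ℝ≥0∞ :=
  ⨅ (F : Finset X) (_ : 1 - ε < μ.real (⋃ x ∈ F, {y | flowHammingDist φ P T x y < ε})),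
    (F.card : ℝ≥0∞)

/-- The metric slow entropy of a flow with respect to the probability measure `μ`. -/
noncomputable def flowMetricSlowEntropy [MeasurableSpace X] (φ : Flow ℝ X) (a : ℝ≥0 → ℝ → ℝ)
    (μ : Measure X) : ℝ≥0∞ :=
  ⨆ (k : ℕ) (P : X → Fin k) (_ : Measurable P),
    limsup (fun ε : ℝ => growthRate a (flowHammingCovering φ μ P ε)) (𝓝[>] 0)

end FlowEntropy

/-! ### Ergodicity, Kronecker systems, ergodic decompositions -/

section Ergodic

variable {X : Type*} [MeasurableSpace X]

/-- `ν` is an ergodic invariant probability measure of the transformation `f`. -/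
structure IsErgodicProb (f : X → X) (ν : Measure X) : Prop where
  prob : IsProbabilityMeasure ν
  ergodic : Ergodic f ν

/-- `ν` is an ergodic invariant probability measure of the flow `φ`. -/
structure IsFlowErgodicProb [TopologicalSpace X] (φ : Flow ℝ X) (ν : Measure X) : Prop where
  prob : IsProbabilityMeasure ν
  measurePreserving : ∀ t, MeasurePreserving (φ t) ν ν
  ergodic : ∀ A : Set X, MeasurableSet A → (∀ t, φ t ⁻¹' A = A) → ν A = 0 ∨ ν Aᶜ = 0

/-- The probability measure `P` on the space of measures is an ergodic decomposition of `μ`: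
it gives full measure to the measures satisfying `erg` (the ergodic ones), and `μ` is the integral
of `ν` with respect to `P(dν)`. -/
structure IsErgodicDecomposition (erg : Measure X → Prop) (μ : Measure X)
    (P : Measure (Measure X)) : Prop where
  prob : IsProbabilityMeasure P
  ergodic : ∀ᵐ ν ∂P, erg ν
  barycenter : ∀ A : Set X, MeasurableSet A → μ A = ∫⁻ ν, ν A ∂P

/-- `Φ` is an isomorphism mod 0 of the measure spaces `(X, μ)` and `(Y, m)`. -/
def IsIsoModZero {Y : Type*} [MeasurableSpace Y] (μ : Measure X) (m : Measure Y) (Φ : X → Y) :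
    Prop :=
  MeasurePreserving Φ μ m ∧ ∃ Ψ : Y → X, MeasurePreserving Ψ m μ ∧
    (∀ᵐ x ∂μ, Ψ (Φ x) = x) ∧ (∀ᵐ y ∂m, Φ (Ψ y) = y)

/-- `(X, μ, f)` is measurably isomorphic to a rotation `y ↦ g + y` of a compact abelian metrizable
group with its normalized Haar measure. -/
def IsKronecker (f : X → X) (μ : Measure X) : Prop :=
  ∃ (G : Type) (_ : AddCommGroup G) (_ : TopologicalSpace G) (_ : IsTopologicalAddGroup G)
    (_ : CompactSpace G) (_ : TopologicalSpace.MetrizableSpace G) (_ : MeasurableSpace G)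
    (_ : BorelSpace G) (m : Measure G) (_ : m.IsAddHaarMeasure) (_ : IsProbabilityMeasure m)
    (g : G) (Φ : X → G), IsIsoModZero μ m Φ ∧ ∀ᵐ x ∂μ, Φ (f x) = g + Φ x

/-- `(X, μ, φ)` is measurably isomorphic to the flow `y ↦ α t + y` of rotations of a compact
abelian metrizable group along a continuous one-parameter subgroup `α`. -/
def IsKroneckerFlow [TopologicalSpace X] (φ : Flow ℝ X) (μ : Measure X) : Prop :=
  ∃ (G : Type) (_ : AddCommGroup G) (_ : TopologicalSpace G) (_ : IsTopologicalAddGroup G)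
    (_ : CompactSpace G) (_ : TopologicalSpace.MetrizableSpace G) (_ : MeasurableSpace G)
    (_ : BorelSpace G) (m : Measure G) (_ : m.IsAddHaarMeasure) (_ : IsProbabilityMeasure m)
    (α : ℝ →+ G) (_ : Continuous α) (Φ : X → G),
    IsIsoModZero μ m Φ ∧ ∀ t, ∀ᵐ x ∂μ, Φ (φ t x) = α t + Φ x

end Ergodic

/-! ### The geodesic flow of the flat torus -/

/-- The flat torus `𝕋² = ℝ² / ℤ²`. -/
abbrev Torus : Type := UnitAddCircle × UnitAddCircle

/-- The projection `ℝ² → 𝕋²`, where `ℝ²` is identified with `ℂ`. -/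
noncomputable def torusProj (z : ℂ) : Torus := ((z.re : UnitAddCircle), (z.im : UnitAddCircle))

/-- The unit tangent bundle `T¹𝕋²`, in its canonical trivialization: a point of the torus and a
unit vector of `ℝ² = ℂ`. -/
abbrev UnitTangentTorus : Type := Torus × Circle

noncomputable instance : MeasurableSpace Circle := borel Circle

instance : BorelSpace Circle := ⟨rfl⟩

/-- The geodesic flow on `T¹𝕋²`: the geodesics of the flat torus are the projections of the
straight lines of `ℝ²`, run through at unit speed with constant direction. -/
noncomputable def geodesicFlow : Flow ℝ UnitTangentTorus where
  toFun t x := (x.1 + torusProj (t * (x.2 : ℂ)), x.2)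
  cont' := by
    have h1 : Continuous torusProj := by
      unfold torusProj
      exact ((AddCircle.continuous_mk' (1 : ℝ)).comp Complex.continuous_re).prodMk
        ((AddCircle.continuous_mk' (1 : ℝ)).comp Complex.continuous_im)
    have h2 : Continuous fun q : ℝ × UnitTangentTorus =>
        torusProj ((q.1 : ℂ) * (q.2.2 : ℂ)) := h1.comp (by fun_prop)
    unfold Function.uncurry
    fun_prop
  map_add' s t x := by
    ext1
    · ext <;> simp [torusProj, add_mul, add_comm, add_left_comm]
    · rfl
  map_zero' x := by
    ext1
    · simp [torusProj]
    · rfl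

/-- The flow is the quotient by `ℤ²` of the geodesic flow of the plane. -/
theorem geodesicFlow_torusProj (t : ℝ) (z : ℂ) (v : Circle) :
    geodesicFlow t (torusProj z, v) = (torusProj (z + t * (v : ℂ)), v) := by
  ext1
  · simp [geodesicFlow, torusProj]
  · rfl

/-- The normalized Haar measure of the circle of directions. -/
noncomputable def circleHaar : Measure Circle := Measure.haarMeasure ⊤

/-- The Haar (Liouville) probability measure of `T¹𝕋²`. -/
noncomputable def unitTangentHaar : Measure UnitTangentTorus :=
  (volume : Measure Torus).prod circleHaar

/-- The Haar measure of the torus `𝕋² × {v}` of the unit tangent vectors of direction `v`. -/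
noncomputable def directionMeasure (v : Circle) : Measure UnitTangentTorus :=
  (volume : Measure Torus).map fun p => (p, v)

end SlowEntropy

namespace SlowEntropy

/-! ### Growth rates -/

section GrowthRate

variable {τ : Type*} [Preorder τ]

/-! The geodesic flow is a shear: on each torus of constant direction it acts by translations, and
nearby directions drift apart linearly in time. All complexity comes from the variation of the
direction.

Upper bound. Orbits whose directions differ by `δ` separate by at most a multiple of `δ T` up to
time `T`, so a fixed net of base points times a net of `O(T)` directions gives a Bowen cover
(`exists_finset_bowen_cover`). Metric slow entropy is at most topological slow entropy by a Lusin
and Markov argument (`exists_codeDist_covering`).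

Lower bound. One partition suffices: the quadrants of the character `e(p₁)`. Along the orbit of `(p,
v)` this character is `e(p₁) e(t Re v)`. If the code `b` of `x` mostly agrees with that of `y`, then
`b` correlates with `e(t Re v)`, where `v` is the direction of `y` (`half_le_norm_correlation`). For
fixed `b` few directions can do so: the second moment of the correlation over the upper half circle,
with weight `sin θ dθ`, is a double integral over times of `b(t)` times the conjugate of `b(s)`
times a kernel of size `min(1, 1/|t - s|)`. It is `O(log T / T)` when the times are spread over
length `T`. Hence at least a constant times `T / log T` Hamming balls are needed, and the logarithm
is invisible at the polynomial scale. Times enter only through a probability measure `τ` on `ℝ`, so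
the flow and its time maps share this argument.

Ergodic measures. The direction is invariant, hence almost surely constant. On such a fibre the
dynamics is isometric, so boundedly many Bowen balls suffice for all times and the slow entropy
vanishes at every scale. The measure sits on one coset of the closed subgroup `H` generated by the
translations used and is `H`-invariant, so it is a translate of Haar measure of `H`.

Decomposition. Fubini writes Haar measure as the average of the measures of constant direction. For
all but countably many directions no nontrivial character is resonant, and the translation is
ergodic. Every ergodic decomposition thus integrates to `0`, whereas the slow entropy of Haar
measure is `1`. -/

theorem growthRate_mono (a : ℝ≥0 → τ → ℝ) {N M : τ → ℝ≥0∞} (h : ∀ᶠ t in atTop, N t ≤ M t) :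
    growthRate a N ≤ growthRate a M := by
  refine iSup₂_le fun χ hχ => ?_
  refine le_iSup₂_of_le χ (hχ.trans_le (limsup_le_limsup ?_)) le_rfl
  filter_upwards [h] with t ht
  gcongr

theorem growthRate_le (a : ℝ≥0 → τ → ℝ) {N : τ → ℝ≥0∞} {c : ℝ≥0} [(atTop : Filter τ).NeBot]
    (h : ∀ χ, c < χ → Tendsto (fun t => N t / ENNReal.ofReal (a χ t)) atTop (𝓝 0)) :
    growthRate a N ≤ c := by
  refine iSup₂_le fun χ hχ => ?_
  by_contra! hlt
  rw [(h χ (by exact_mod_cast hlt)).limsup_eq] at hχ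
  exact lt_irrefl _ hχ

/-- The function `a 0` is nondecreasing and positive, hence bounded below from `t₀` on, and `a χ`
dominates it by an arbitrarily large factor. -/
theorem IsScale.tendsto_atTop {τ : Type*} [Preorder τ] [Zero τ] {a : ℝ≥0 → τ → ℝ}
    (ha : IsScale a) {t₀ : τ} (ht₀ : 0 < t₀) (ht : ∀ᶠ t in atTop, t₀ ≤ t) {χ : ℝ≥0}
    (hχ : 0 < χ) : Tendsto (a χ) atTop atTop := by
  have hlo := ha.isLittleO 0 χ hχ
  refine Filter.tendsto_atTop.2 fun b => ?_
  have hc : 0 < a 0 t₀ / (|b| + 1) := div_pos (ha.pos 0 t₀ ht₀) (by positivity)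
  filter_upwards [hlo.bound hc, ht] with t h1 h2
  have hpos : 0 < t := ht₀.trans_le h2
  have h3 : a 0 t₀ ≤ a 0 t := ha.mono 0 ht₀ hpos h2
  rw [Real.norm_of_nonneg (ha.pos 0 t hpos).le, Real.norm_of_nonneg (ha.pos χ t hpos).le] at h1
  have h4 : a 0 t₀ * 1 ≤ a 0 t₀ * (a χ t / (|b| + 1)) := by
    calc a 0 t₀ * 1 ≤ a 0 t := by linarith
      _ ≤ _ := h1
      _ = _ := by ring
  have h5 := le_of_mul_le_mul_left h4 (ha.pos 0 t₀ ht₀)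
  rw [le_div_iff₀ (by positivity)] at h5
  linarith [le_abs_self b]

/-- Only exponents `χ > 0` need to be excluded: `χ = 0` may well satisfy the limsup condition, but
it contributes `0` to the supremum. -/
theorem growthRate_eq_zero_of_bounded {τ : Type*} [Preorder τ] [Zero τ]
    [(atTop : Filter τ).NeBot] {a : ℝ≥0 → τ → ℝ}
    (ha : IsScale a) {t₀ : τ} (ht₀ : 0 < t₀) (ht : ∀ᶠ t in atTop, t₀ ≤ t) {N : τ → ℝ≥0∞}
    {C : ℝ≥0∞} (hC : C ≠ ∞) (hN : ∀ᶠ t in atTop, N t ≤ C) : growthRate a N = 0 := by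
  refine le_antisymm ?_ zero_le
  refine (growthRate_le a (c := 0) fun χ hχ => ?_).trans (by simp)
  have h1 : Tendsto (fun t => ENNReal.ofReal (a χ t)) atTop (𝓝 ∞) :=
    ENNReal.tendsto_ofReal_atTop.comp (ha.tendsto_atTop ht₀ ht hχ)
  have h2 : Tendsto (fun t => C / ENNReal.ofReal (a χ t)) atTop (𝓝 0) := by
    simpa using ENNReal.Tendsto.const_div h1 (Or.inr hC)
  refine tendsto_of_tendsto_of_tendsto_of_le_of_le' tendsto_const_nhds h2 (by simp) ?_
  filter_upwards [hN] with t ht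
  gcongr

/-- A function that grows at most linearly along a parametrization `u` of the times has growth
rate at most one at the polynomial scale. -/
theorem growthRate_rpow_le_one {τ : Type*} [Preorder τ] [(atTop : Filter τ).NeBot]
    {u : τ → ℝ} (hu : Tendsto u atTop atTop) {N : τ → ℝ≥0∞} {C : ℝ}
    (hN : ∀ᶠ t in atTop, N t ≤ ENNReal.ofReal (C * u t)) :
    growthRate (fun χ t => u t ^ (χ : ℝ)) N ≤ 1 := by
  refine (growthRate_le _ (c := 1) fun χ hχ => ?_).trans (by simp)
  have hχ' : (1 : ℝ) < χ := by exact_mod_cast hχ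
  have h1 : Tendsto (fun t => C * u t ^ (-((χ : ℝ) - 1))) atTop (𝓝 (C * 0)) :=
    ((tendsto_rpow_neg_atTop (by linarith)).comp hu).const_mul C
  have h2 := (ENNReal.continuous_ofReal.tendsto _).comp h1
  rw [mul_zero, ENNReal.ofReal_zero] at h2
  refine tendsto_of_tendsto_of_tendsto_of_le_of_le' tendsto_const_nhds h2 (by simp) ?_
  filter_upwards [hN, hu.eventually_gt_atTop 0] with t ht hpos
  calc N t / ENNReal.ofReal (u t ^ (χ : ℝ))
      ≤ ENNReal.ofReal (C * u t) / ENNReal.ofReal (u t ^ (χ : ℝ)) := by gcongr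
    _ = ENNReal.ofReal (C * u t / u t ^ (χ : ℝ)) :=
        (ENNReal.ofReal_div_of_pos (Real.rpow_pos_of_pos hpos _)).symm
    _ = _ := by
        simp only [Function.comp]
        rw [neg_sub, Real.rpow_sub hpos, Real.rpow_one, mul_div_assoc]

/-- If `N ≥ c T / (C j + 1)` at the times `T = 2 ^ j`, then the growth rate of `N` at the polynomial
scale is at least one. -/
theorem one_le_growthRate_rpow {τ : Type*} [Preorder τ]
    {u : τ → ℝ} {w : ℕ → τ} (hw : Tendsto w atTop atTop) (hu : ∀ j, u (w j) = 2 ^ j)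
    {N : τ → ℝ≥0∞} {c C : ℝ} (hc : 0 < c) (hC : 0 ≤ C)
    (hN : ∀ j : ℕ, ENNReal.ofReal (c * 2 ^ j / (C * j + 1)) ≤ N (w j)) :
    1 ≤ growthRate (fun χ t => u t ^ (χ : ℝ)) N := by
  refine le_of_forall_lt fun b hb => ?_
  lift b to ℝ≥0 using hb.ne_top
  obtain ⟨χ, hbχ, hχ⟩ := exists_between (show b < 1 by exact_mod_cast hb)
  have hχ' : (χ : ℝ) < 1 := by exact_mod_cast hχ
  refine lt_of_lt_of_le (show (b : ℝ≥0∞) < χ by exact_mod_cast hbχ) ?_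
  refine le_iSup₂_of_le χ (lt_of_lt_of_le one_pos ?_) le_rfl
  -- A limsup only needs a lower bound along the times `w j`.
  refine le_limsup_of_frequently_le ?_
  refine hw.frequently (Eventually.frequently ?_)
  -- Since `(2 ^ j) ^ χ = 2 ^ j / r ^ j`, the quotient is at least `c r ^ j / (C j + 1)`; the
  -- geometric factor beats the linear (logarithmic in time) loss.
  set r : ℝ := 2 ^ ((1 : ℝ) - χ) with hr
  have hr1 : 1 < r := Real.one_lt_rpow (by norm_num) (by linarith)
  have hlim : Tendsto (fun j : ℕ => (C * j + 1) / r ^ j) atTop (𝓝 0) := by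
    have h1 := (tendsto_pow_const_div_const_pow_of_one_lt 1 hr1).const_mul C
    have h2 := (tendsto_pow_const_div_const_pow_of_one_lt 0 hr1)
    have h3 := h1.add h2
    simp only [mul_zero, add_zero, pow_one, pow_zero] at h3
    refine h3.congr fun j => by ring
  filter_upwards [hlim.eventually (gt_mem_nhds hc)] with j hj
  have hpos : (0 : ℝ) < C * j + 1 := by positivity
  have hrj : 0 < r ^ j := by positivity
  have h2j : ((2 : ℝ) ^ j) ^ (χ : ℝ) = 2 ^ j / r ^ j := by
    rw [hr, ← Real.rpow_natCast, ← Real.rpow_natCast, ← Real.rpow_mul (by norm_num),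
      ← Real.rpow_mul (by norm_num), ← Real.rpow_sub (by norm_num)]
    congr 1; ring
  rw [ENNReal.le_div_iff_mul_le (Or.inl ?_) (Or.inl ENNReal.ofReal_ne_top), one_mul]
  · refine le_trans (ENNReal.ofReal_le_ofReal ?_) (hN j)
    rw [hu, h2j, mul_comm c, mul_div_assoc, div_eq_mul_inv]
    gcongr
    rw [inv_le_comm₀ hrj (by positivity), inv_div, div_le_iff₀ hc]
    rw [div_lt_iff₀ hrj] at hj
    linarith
  · rw [hu]; simp only [ne_eq, ENNReal.ofReal_eq_zero, not_le]; positivity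

end GrowthRate

/-! ### Hamming distances with respect to a distribution of times -/

section Codes

variable {X : Type*} [MetricSpace X] [MeasurableSpace X] [BorelSpace X]

/-- The probability, with respect to the distribution `τ` of times, that the orbits of `x` and `y`
lie in different atoms of the partition into the fibres of `P`. -/
noncomputable def codeDist (φ : Flow ℝ X) (τ : Measure ℝ) {k : ℕ} (P : X → Fin k) (x y : X) : ℝ :=
  τ.real {t | P (φ t x) ≠ P (φ t y)}

/-- The uniform distribution on the first `n` multiples of `s`. -/
noncomputable def discreteTime (s : ℝ) (n : ℕ) : Measure ℝ :=
  (n : ℝ≥0∞)⁻¹ • ∑ i ∈ Finset.range n, Measure.dirac (i * s)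

/-- The uniform distribution on `[0, T]`. -/
noncomputable def uniformTime (T : ℝ) : Measure ℝ :=
  (ENNReal.ofReal T)⁻¹ • (volume : Measure ℝ).restrict (Icc 0 T)

theorem flow_iterate {X : Type*} [TopologicalSpace X] (φ : Flow ℝ X) (s : ℝ) (i : ℕ) (x : X) : (φ s)^[i] x = φ (i * s) x := by
  induction i with
  | zero => simp
  | succ i ih => rw [Function.iterate_succ_apply', ih, ← Flow.map_add]; push_cast; ring_nf

theorem measurable_flow_left [SecondCountableTopology X] (φ : Flow ℝ X) (x : X) :
    Measurable fun t => φ t x :=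
  (φ.cont'.comp (by fun_prop : Continuous fun t : ℝ => (t, x))).measurable

theorem discreteTime_apply (s : ℝ) (n : ℕ) (A : Set ℝ) :
    discreteTime s n A = (n : ℝ≥0∞)⁻¹ * ∑ i ∈ Finset.range n, A.indicator 1 (i * s) := by
  simp [discreteTime]

open scoped Classical in
theorem discreteTime_real (s : ℝ) (n : ℕ) (A : Set ℝ) :
    (discreteTime s n).real A =
      (((Finset.range n).filter fun i : ℕ => (i : ℝ) * s ∈ A).card : ℝ) / n := by
  rw [Measure.real, discreteTime_apply, ENNReal.toReal_mul, ENNReal.toReal_inv,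
    ENNReal.toReal_natCast, div_eq_inv_mul]
  congr 1
  rw [Finset.card_filter]
  simp only [Set.indicator_apply, Pi.one_apply]
  rw [ENNReal.toReal_sum (fun i _ => by split_ifs <;> simp)]
  push_cast
  refine Finset.sum_congr rfl fun i _ => by split_ifs <;> simp

theorem isProbabilityMeasure_discreteTime (s : ℝ) {n : ℕ} (hn : 0 < n) :
    IsProbabilityMeasure (discreteTime s n) := by
  constructor
  rw [discreteTime_apply]
  simp only [mem_univ, indicator_of_mem, Pi.one_apply, Finset.sum_const, Finset.card_range,
    nsmul_eq_mul, mul_one]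
  exact ENNReal.inv_mul_cancel (by simpa using hn.ne') (by simp)

theorem isProbabilityMeasure_uniformTime {T : ℝ} (hT : 0 < T) :
    IsProbabilityMeasure (uniformTime T) := by
  constructor
  simp only [uniformTime, Measure.smul_apply, Measure.restrict_apply_univ, Real.volume_Icc,
    sub_zero, smul_eq_mul]
  exact ENNReal.inv_mul_cancel (by simpa using hT) (by simp)

theorem hammingDist_eq_codeDist {X : Type*} [MetricSpace X] (φ : Flow ℝ X) (s : ℝ) {n : ℕ} (hn : 0 < n) {k : ℕ}
    (P : X → Fin k) (x y : X) :
    hammingDist (φ s) P n x y = codeDist φ (discreteTime s n) P x y := by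
  classical
  rw [hammingDist, codeDist, discreteTime_real]
  have hn' : (n : ℝ) ≠ 0 := by positivity
  have h := Finset.card_filter_add_card_filter_not (s := Finset.range n)
    (fun i => P ((φ s)^[i] x) = P ((φ s)^[i] y))
  rw [Finset.card_range] at h
  simp only [flow_iterate] at h ⊢
  rw [eq_div_iff hn', sub_mul, div_mul_cancel₀ _ hn', one_mul, sub_eq_iff_eq_add, add_comm]
  simp only [mem_ofPred_eq]
  exact_mod_cast h.symm

theorem flowHammingDist_eq_codeDist [SecondCountableTopology X] (φ : Flow ℝ X) {T : ℝ}
    (hT : 0 < T) {k : ℕ} {P : X → Fin k} (hP : Measurable P) (x y : X) :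
    flowHammingDist φ P T x y = codeDist φ (uniformTime T) P x y := by
  have hA : MeasurableSet {t | P (φ t x) = P (φ t y)} :=
    measurableSet_eq_fun (hP.comp (measurable_flow_left φ x)) (hP.comp (measurable_flow_left φ y))
  have := isProbabilityMeasure_uniformTime hT
  have h1 : {t | P (φ t x) ≠ P (φ t y)} = {t | P (φ t x) = P (φ t y)}ᶜ := rfl
  rw [flowHammingDist, codeDist, h1, probReal_compl_eq_one_sub hA]
  congr 1
  have h2 : {t | t ∈ Icc 0 T ∧ P (φ t x) = P (φ t y)} = {t | P (φ t x) = P (φ t y)} ∩ Icc 0 T := by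
    ext t; simp [and_comm]
  rw [h2, uniformTime, measureReal_ennreal_smul_apply, measureReal_restrict_apply hA,
    ENNReal.toReal_inv, ENNReal.toReal_ofReal hT.le, div_eq_inv_mul]

/-- A Borel partition is uniformly continuous off a set of small measure. Along an orbit that
rarely visits this set, points that stay close to each other have similar codes. Thus coverings by
Bowen balls lead to coverings by Hamming balls. -/
theorem exists_codeDist_covering [CompactSpace X] (φ : Flow ℝ X) (μ : Measure X)
    [IsProbabilityMeasure μ] {k : ℕ} {P : X → Fin k} (hP : Measurable P) {ε : ℝ} (hε : 0 < ε) :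
    ∃ r > 0, ∀ (τ : Measure ℝ) [IsProbabilityMeasure τ] (Z : Set X) (L : Set ℝ) (F : Finset X),
      (∀ᵐ t ∂τ, MeasurePreserving (φ t) μ μ) → (∀ᵐ x ∂μ, x ∈ Z) → (∀ᵐ t ∂τ, t ∈ L) →
      Z ⊆ ⋃ x ∈ F, {y | ∀ t ∈ L, dist (φ t x) (φ t y) < r} →
      ∃ F' : Finset X, F'.card ≤ F.card ∧
        1 - ε < μ.real (⋃ x ∈ F', {y | codeDist φ τ P x y < ε}) := by
  classical
  -- The `k` atoms lose mass at most `δ` each. A bad set of mass below `(ε / 2) ε` leaves, by Markov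
  -- with threshold `ε / 2`, an exceptional set of orbits of mass below `ε`.
  obtain ⟨δ, hδ0, hδ⟩ : ∃ δ : ℝ≥0∞, δ ≠ 0 ∧ k * δ < ENNReal.ofReal (ε / 2) * ENNReal.ofReal ε := by
    have hpos : 0 < ENNReal.ofReal (ε / 2) * ENNReal.ofReal ε :=
      ENNReal.mul_pos (by simpa using hε) (by simpa using hε)
    obtain ⟨δ, hδ0, hδ⟩ := ENNReal.exists_nnreal_pos_mul_lt (a := (k : ℝ≥0∞)) (by simp) hpos.ne'
    exact ⟨δ, by exact_mod_cast hδ0.ne', by rwa [mul_comm]⟩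
  have hK : ∀ i : Fin k, ∃ K ⊆ P ⁻¹' {i}, IsCompact K ∧ μ (P ⁻¹' {i} \ K) < δ := fun i =>
    (hP (measurableSet_singleton i)).exists_isCompact_sdiff_lt (measure_ne_top μ _) hδ0
  choose K hKP hKc hKμ using hK
  have hthick : ∀ i j : Fin k, ∃ r > 0, i ≠ j → ∀ x ∈ K i, ∀ y ∈ K j, r ≤ dist x y := by
    intro i j
    by_cases hij : i = j
    · exact ⟨1, one_pos, fun h => absurd hij h⟩
    · have hd : Disjoint (K i) (K j) := by
        refine Set.disjoint_left.2 fun x hx hx' => hij ?_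
        have h1 : P x = i := hKP i hx
        have h2 : P x = j := hKP j hx'
        exact h1.symm.trans h2
      obtain ⟨r, hr, hdisj⟩ := hd.exists_thickenings (hKc i) (hKc j).isClosed
      refine ⟨r, hr, fun _ x hx y hy => ?_⟩
      by_contra! hlt
      refine Set.disjoint_left.1 hdisj (Metric.self_subset_thickening hr _ hx)
        (Metric.mem_thickening_iff.2 ⟨y, hy, hlt⟩)
  choose r hr0 hr using hthick
  obtain ⟨ρ, hρ0, hρ⟩ : ∃ ρ > 0, ∀ i j, ρ ≤ r i j := by
    have h : ∀ᶠ ρ in 𝓝[>] (0 : ℝ), ∀ i j, ρ ≤ r i j :=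
      eventually_all.2 fun i => eventually_all.2 fun j =>
        eventually_nhdsWithin_of_eventually_nhds (eventually_le_nhds (hr0 i j))
    obtain ⟨ρ, hρ, hρ0⟩ := (h.and self_mem_nhdsWithin).exists
    exact ⟨ρ, hρ0, hρ⟩
  -- Off `B` each point lies in one of finitely many compact sets at mutual distance at least `ρ`,
  -- so `ρ`-close points have equal codes.
  set B : Set X := (⋃ i, K i)ᶜ with hB
  have hBm : MeasurableSet B := (MeasurableSet.iUnion fun i => (hKc i).measurableSet).compl
  have hBμ : μ B < ENNReal.ofReal (ε / 2) * ENNReal.ofReal ε := by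
    refine lt_of_le_of_lt ?_ hδ
    have hsub : B ⊆ ⋃ i, (P ⁻¹' {i} \ K i) := fun x hx =>
      mem_iUnion.2 ⟨P x, rfl, fun h => hx (mem_iUnion.2 ⟨_, h⟩)⟩
    calc μ B ≤ ∑ i, μ (P ⁻¹' {i} \ K i) := (measure_mono hsub).trans (measure_iUnion_fintype_le _ _)
      _ ≤ ∑ _i : Fin k, δ := Finset.sum_le_sum fun i _ => (hKμ i).le
      _ = k * δ := by simp
  have hcode : ∀ x y, x ∉ B → y ∉ B → dist x y < ρ → P x = P y := by
    intro x y hx hy hxy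
    obtain ⟨i, hi⟩ := mem_iUnion.1 (not_not.1 hx)
    obtain ⟨j, hj⟩ := mem_iUnion.1 (not_not.1 hy)
    have h1 : P x = i := hKP i hi
    have h2 : P y = j := hKP j hj
    by_contra hne
    rw [h1, h2] at hne
    linarith [hρ i j, hr i j hne x hi y hj]
  -- Half of `ρ`, because the balls are recentred below and the triangle inequality is used once.
  refine ⟨ρ / 2, by positivity, fun τ _ Z L F hinv hZ hL hF => ?_⟩
  -- The proportion of bad times along an orbit, and the orbits for which it is small.
  set b : X → ℝ≥0∞ := fun x => τ {t | φ t x ∈ B} with hb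
  have hjoint : MeasurableSet {q : X × ℝ | φ q.2 q.1 ∈ B} := by
    have : Measurable fun q : X × ℝ => φ q.2 q.1 :=
      (φ.cont'.comp (by fun_prop : Continuous fun q : X × ℝ => (q.2, q.1))).measurable
    exact this hBm
  have hbm : Measurable b := measurable_measure_prodMk_left hjoint
  -- Fubini and invariance: the mean proportion of bad times is the mass of `B`.
  have hbint : ∫⁻ x, b x ∂μ = μ B := by
    have h1 := Measure.prod_apply (μ := μ) (ν := τ) hjoint
    have h2 := Measure.prod_apply_symm (μ := μ) (ν := τ) hjoint
    rw [h1] at h2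
    refine (h2.trans ?_ : _)
    calc ∫⁻ t, μ ((fun x => (x, t)) ⁻¹' {q : X × ℝ | φ q.2 q.1 ∈ B}) ∂τ = ∫⁻ _t, μ B ∂τ := by
          refine lintegral_congr_ae ?_
          filter_upwards [hinv] with t ht
          exact ht.measure_preimage hBm.nullMeasurableSet
      _ = μ B := by simp
  set E : Set X := {x | b x < ENNReal.ofReal (ε / 2)} with hE
  have hEm : MeasurableSet E := measurableSet_lt hbm measurable_const
  have hEμ : μ Eᶜ < ENNReal.ofReal ε := by
    have h0 : ENNReal.ofReal (ε / 2) ≠ 0 := by simpa using hε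
    have h1 : Eᶜ = {x | ENNReal.ofReal (ε / 2) ≤ b x} := by ext x; simp [hE]
    rw [h1]
    refine (meas_ge_le_lintegral_div hbm.aemeasurable h0 ENNReal.ofReal_ne_top).trans_lt ?_
    rw [hbint]
    exact ENNReal.div_lt_of_lt_mul' hBμ
  set ball : X → Set X := fun x => {y | ∀ t ∈ L, dist (φ t x) (φ t y) < ρ / 2} with hball
  -- A given centre may have a bad orbit. It is replaced by a good point of its ball whenever there
  -- is one.
  have hch : ∀ x, ∃ z, (∃ y, y ∈ E ∩ ball x) → z ∈ E ∩ ball x := by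
    intro x
    by_cases h : ∃ y, y ∈ E ∩ ball x
    · exact ⟨h.choose, fun _ => h.choose_spec⟩
    · exact ⟨x, fun h' => absurd h' h⟩
  choose z hz using hch
  refine ⟨F.image z, Finset.card_image_le, ?_⟩
  have hEZ : E ∩ Z ⊆ ⋃ x ∈ F.image z, {y | codeDist φ τ P x y < ε} := by
    rintro y ⟨hyE, hyZ⟩
    obtain ⟨x, hxF, hyx⟩ := mem_iUnion₂.1 (hF hyZ)
    obtain ⟨hzE, hzx⟩ := hz x ⟨y, hyE, hyx⟩
    refine mem_iUnion₂.2 ⟨z x, Finset.mem_image_of_mem z hxF, ?_⟩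
    have hsub : {t | P (φ t (z x)) ≠ P (φ t y)} ⊆
        ({t | φ t (z x) ∈ B} ∪ {t | φ t y ∈ B}) ∪ Lᶜ := by
      intro t ht
      by_contra hcon
      simp only [mem_union, mem_ofPred_eq, mem_compl_iff, not_or, not_not] at hcon
      refine ht (hcode _ _ hcon.1.1 hcon.1.2 ?_)
      have h1 := hzx t hcon.2
      have h2 := hyx t hcon.2
      calc dist (φ t (z x)) (φ t y) ≤ dist (φ t x) (φ t (z x)) + dist (φ t x) (φ t y) :=
            dist_triangle_left _ _ _
        _ < ρ := by linarith
    have hlt : τ {t | P (φ t (z x)) ≠ P (φ t y)} < ENNReal.ofReal ε := by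
      calc τ {t | P (φ t (z x)) ≠ P (φ t y)} ≤ b (z x) + b y + τ Lᶜ :=
            (measure_mono hsub).trans ((measure_union_le _ _).trans
              (add_le_add (measure_union_le _ _) le_rfl))
        _ = b (z x) + b y := by rw [show τ Lᶜ = 0 from hL, add_zero]
        _ < ENNReal.ofReal (ε / 2) + ENNReal.ofReal (ε / 2) := ENNReal.add_lt_add hzE hyE
        _ = ENNReal.ofReal ε := by rw [← ENNReal.ofReal_add] <;> [congr 1; skip; skip] <;> linarith
    rw [mem_ofPred_eq, codeDist, Measure.real]
    exact (ENNReal.lt_ofReal_iff_toReal_lt hlt.ne_top).1 hlt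
  have h1 : μ.real E ≤ μ.real (⋃ x ∈ F.image z, {y | codeDist φ τ P x y < ε}) := by
    refine ENNReal.toReal_mono (measure_ne_top _ _) ?_
    calc μ E = μ (E ∩ Z) := (measure_inter_conull hZ).symm
      _ ≤ _ := measure_mono hEZ
  have h2 : μ.real Eᶜ < ε := (ENNReal.lt_ofReal_iff_toReal_lt hEμ.ne_top).1 hEμ
  rw [probReal_compl_eq_one_sub hEm] at h2
  linarith

end Codes


/-! ### Comparison of metric and topological slow entropy -/

section Comparison

variable {X : Type*} [MetricSpace X] [MeasurableSpace X] [BorelSpace X] [CompactSpace X]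

theorem ae_discreteTime {s : ℝ} {n : ℕ} {p : ℝ → Prop} (h : ∀ i < n, p (i * s)) :
    ∀ᵐ t ∂discreteTime s n, p t := by
  rw [ae_iff, discreteTime_apply]
  refine mul_eq_zero_of_right _ (Finset.sum_eq_zero fun i hi => ?_)
  exact indicator_of_notMem (by simpa using h i (Finset.mem_range.1 hi)) _

theorem ae_uniformTime {T : ℝ} : ∀ᵐ t ∂uniformTime T, t ∈ Icc 0 T :=
  Measure.ae_smul_measure (ae_restrict_mem measurableSet_Icc) _

/-- The radius is chosen before the time and the carrier `Z`. Letting `Z` be any set of full measure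
is what makes the bound usable for measures living on one fibre. -/
theorem exists_hammingCovering_le (φ : Flow ℝ X) (s : ℝ) (μ : Measure X) [IsProbabilityMeasure μ]
    (hμ : MeasurePreserving (φ s) μ μ) {k : ℕ} {P : X → Fin k} (hP : Measurable P) {ε : ℝ}
    (hε : 0 < ε) :
    ∃ r > 0, ∀ (n : ℕ) (Z : Set X) (F : Finset X), 0 < n → (∀ᵐ x ∂μ, x ∈ Z) →
      Z ⊆ ⋃ x ∈ F, bowenBall (φ s) n r x → hammingCovering (φ s) μ P ε n ≤ F.card := by
  obtain ⟨r, hr, H⟩ := exists_codeDist_covering φ μ hP hε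
  refine ⟨r, hr, fun n Z F hn hZ hF => ?_⟩
  have := isProbabilityMeasure_discreteTime s hn
  have hcov : Z ⊆ ⋃ x ∈ F, {y | ∀ t ∈ {t : ℝ | ∃ i < n, t = i * s}, dist (φ t x) (φ t y) < r} := by
    refine hF.trans (iUnion₂_mono fun x _ y hy => ?_)
    rintro t ⟨i, hi, rfl⟩
    have h := hy i hi
    rwa [flow_iterate, flow_iterate] at h
  obtain ⟨F', hcard, hF'⟩ := H (discreteTime s n) Z {t | ∃ i < n, t = i * s} F
    (ae_discreteTime fun i _ => by
      have h := hμ.iterate i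
      rwa [show (φ s)^[i] = φ (i * s) from funext fun x => flow_iterate φ s i x] at h)
    hZ (ae_discreteTime fun i hi => ⟨i, hi, rfl⟩) hcov
  refine (iInf₂_le F' ?_).trans (by exact_mod_cast hcard)
  simpa only [hammingDist_eq_codeDist φ s hn] using hF'

theorem exists_flowHammingCovering_le (φ : Flow ℝ X) (μ : Measure X) [IsProbabilityMeasure μ]
    (hμ : ∀ t, MeasurePreserving (φ t) μ μ) {k : ℕ} {P : X → Fin k} (hP : Measurable P) {ε : ℝ}
    (hε : 0 < ε) :
    ∃ r > 0, ∀ (T : ℝ) (Z : Set X) (F : Finset X), 0 < T → (∀ᵐ x ∂μ, x ∈ Z) →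
      Z ⊆ ⋃ x ∈ F, flowBowenBall φ T r x → flowHammingCovering φ μ P ε T ≤ F.card := by
  obtain ⟨r, hr, H⟩ := exists_codeDist_covering φ μ hP hε
  refine ⟨r, hr, fun T Z F hT hZ hF => ?_⟩
  have := isProbabilityMeasure_uniformTime hT
  obtain ⟨F', hcard, hF'⟩ := H (uniformTime T) Z (Icc 0 T) F (Eventually.of_forall hμ) hZ
    ae_uniformTime hF
  refine (iInf₂_le F' ?_).trans (by exact_mod_cast hcard)
  simpa only [flowHammingDist_eq_codeDist φ hT hP] using hF'

/-- For fixed `ε` every Bowen radius below the threshold `r` already bounds the Hamming covering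
numbers, so the two limits need not be coupled. By compactness the whole space is an admissible `K`.
-/
theorem metricSlowEntropy_le_topSlowEntropy (φ : Flow ℝ X) (s : ℝ) (μ : Measure X)
    [IsProbabilityMeasure μ] (hμ : MeasurePreserving (φ s) μ μ) (a : ℝ≥0 → ℕ → ℝ) :
    metricSlowEntropy (φ s) a μ ≤ topSlowEntropy (φ s) a := by
  refine iSup₂_le fun k P => iSup_le fun hP => ?_
  refine limsup_le_of_le (h := eventually_nhdsWithin_of_forall fun ε (hε : 0 < ε) => ?_)
  obtain ⟨r, hr, H⟩ := exists_hammingCovering_le φ s μ hμ hP hε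
  refine le_iSup₂_of_le univ isCompact_univ ?_
  refine le_limsup_of_frequently_le (Eventually.frequently ?_)
  filter_upwards [Ioc_mem_nhdsGT hr] with δ hδ
  refine growthRate_mono a ((eventually_gt_atTop 0).mono fun n hn => ?_)
  refine le_iInf₂ fun F hF => H n univ F hn (by simp) (hF.trans ?_)
  exact iUnion₂_mono fun x _ y hy i hi => (hy i hi).trans_le hδ.2

theorem flowMetricSlowEntropy_le_flowTopSlowEntropy (φ : Flow ℝ X) (μ : Measure X)
    [IsProbabilityMeasure μ] (hμ : ∀ t, MeasurePreserving (φ t) μ μ) (a : ℝ≥0 → ℝ → ℝ) :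
    flowMetricSlowEntropy φ a μ ≤ flowTopSlowEntropy φ a := by
  refine iSup₂_le fun k P => iSup_le fun hP => ?_
  refine limsup_le_of_le (h := eventually_nhdsWithin_of_forall fun ε (hε : 0 < ε) => ?_)
  obtain ⟨r, hr, H⟩ := exists_flowHammingCovering_le φ μ hμ hP hε
  refine le_iSup₂_of_le univ isCompact_univ ?_
  refine le_limsup_of_frequently_le (Eventually.frequently ?_)
  filter_upwards [Ioc_mem_nhdsGT hr] with δ hδ
  refine growthRate_mono a ((eventually_gt_atTop 0).mono fun T hT => ?_)
  refine le_iInf₂ fun F hF => H T univ F hT (by simp) (hF.trans ?_)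
  exact iUnion₂_mono fun x _ y hy t ht => (hy t ht).trans_le hδ.2

/-- A measure carried by a set that, for every `r`, is covered by finitely many `r`-Bowen balls
of infinite length has slow entropy zero at every scale. -/
theorem metricSlowEntropy_eq_zero (φ : Flow ℝ X) (s : ℝ) (μ : Measure X) [IsProbabilityMeasure μ]
    (hμ : MeasurePreserving (φ s) μ μ) {Z : Set X} (hZ : ∀ᵐ x ∂μ, x ∈ Z)
    (hF : ∀ r > 0, ∃ F : Finset X, Z ⊆ ⋃ x ∈ F, {y | ∀ t, dist (φ t x) (φ t y) < r})
    {a : ℝ≥0 → ℕ → ℝ} (ha : IsScale a) : metricSlowEntropy (φ s) a μ = 0 := by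
  refine le_antisymm (iSup₂_le fun k P => iSup_le fun hP => ?_) zero_le
  refine limsup_le_of_le (h := eventually_nhdsWithin_of_forall fun ε (hε : 0 < ε) => ?_)
  obtain ⟨r, hr, H⟩ := exists_hammingCovering_le φ s μ hμ hP hε
  obtain ⟨F, hF⟩ := hF r hr
  refine (growthRate_eq_zero_of_bounded ha one_pos (eventually_ge_atTop 1)
    (C := F.card) (by simp) ?_).le
  filter_upwards [eventually_gt_atTop 0] with n hn
  refine H n Z F hn hZ (hF.trans (iUnion₂_mono fun x _ y hy i _ => ?_))
  rw [flow_iterate, flow_iterate]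
  exact hy _

theorem flowMetricSlowEntropy_eq_zero (φ : Flow ℝ X) (μ : Measure X) [IsProbabilityMeasure μ]
    (hμ : ∀ t, MeasurePreserving (φ t) μ μ) {Z : Set X} (hZ : ∀ᵐ x ∂μ, x ∈ Z)
    (hF : ∀ r > 0, ∃ F : Finset X, Z ⊆ ⋃ x ∈ F, {y | ∀ t, dist (φ t x) (φ t y) < r})
    {a : ℝ≥0 → ℝ → ℝ} (ha : IsScale a) : flowMetricSlowEntropy φ a μ = 0 := by
  refine le_antisymm (iSup₂_le fun k P => iSup_le fun hP => ?_) zero_le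
  refine limsup_le_of_le (h := eventually_nhdsWithin_of_forall fun ε (hε : 0 < ε) => ?_)
  obtain ⟨r, hr, H⟩ := exists_flowHammingCovering_le φ μ hμ hP hε
  obtain ⟨F, hF⟩ := hF r hr
  refine (growthRate_eq_zero_of_bounded ha one_pos (eventually_ge_atTop 1)
    (C := F.card) (by simp) ?_).le
  filter_upwards [eventually_gt_atTop 0] with T hT
  exact H T Z F hT hZ (hF.trans (iUnion₂_mono fun x _ y hy t _ => hy t))

end Comparison

/-! ### Bowen balls of the geodesic flow -/

theorem geodesicFlow_apply (t : ℝ) (x : UnitTangentTorus) :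
    geodesicFlow t x = (x.1 + torusProj (t * (x.2 : ℂ)), x.2) := rfl

theorem torusProj_add (z w : ℂ) : torusProj (z + w) = torusProj z + torusProj w := by
  ext <;> simp [torusProj]

theorem norm_torusProj_le (z : ℂ) : ‖torusProj z‖ ≤ ‖z‖ := by
  have h : ∀ x : ℝ, ‖(x : UnitAddCircle)‖ ≤ |x| := fun x => by
    simpa using QuotientAddGroup.norm_mk_le_norm (S := AddSubgroup.zmultiples (1 : ℝ)) (m := x)
  exact max_le ((h _).trans (Complex.abs_re_le_norm z)) ((h _).trans (Complex.abs_im_le_norm z))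

theorem circle_dist_eq (v w : Circle) : dist v w = ‖(v : ℂ) - w‖ := by
  rw [← dist_eq_norm]
  rfl

/-- The shear estimate: base points drift apart at speed at most the distance of the directions. The
summand `1` accounts for the direction component of the sup metric. -/
theorem dist_geodesicFlow_le (t : ℝ) (x y : UnitTangentTorus) :
    dist (geodesicFlow t x) (geodesicFlow t y) ≤ dist x.1 y.1 + (|t| + 1) * dist x.2 y.2 := by
  have h1 : dist (torusProj (t * (x.2 : ℂ))) (torusProj (t * (y.2 : ℂ))) ≤
      |t| * dist x.2 y.2 := by
    have h2 : torusProj (t * (x.2 : ℂ)) - torusProj (t * (y.2 : ℂ)) =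
        torusProj (t * ((x.2 : ℂ) - y.2)) := by
      rw [sub_eq_iff_eq_add, ← torusProj_add]; ring_nf
    rw [dist_eq_norm, h2]
    refine (norm_torusProj_le _).trans ?_
    rw [norm_mul, Complex.norm_real, Real.norm_eq_abs, circle_dist_eq]
  have h3 := dist_add_add_le x.1 (torusProj (t * (x.2 : ℂ))) y.1 (torusProj (t * (y.2 : ℂ)))
  rw [geodesicFlow_apply, geodesicFlow_apply, Prod.dist_eq]
  refine max_le ?_ ?_
  · dsimp only
    nlinarith [dist_nonneg (x := x.2) (y := y.2)]
  · dsimp only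
    nlinarith [dist_nonneg (x := x.2) (y := y.2), dist_nonneg (x := x.1) (y := y.1),
      mul_nonneg (abs_nonneg t) (dist_nonneg (x := x.2) (y := y.2))]

theorem exists_finset_torus_cover {r : ℝ} (hr : 0 < r) :
    ∃ F : Finset Torus, ∀ p, ∃ q ∈ F, dist q p < r := by
  obtain ⟨F, -, hfin, hF⟩ := (isCompact_univ (X := Torus)).finite_cover_balls hr
  refine ⟨hfin.toFinset, fun p => ?_⟩
  obtain ⟨q, hq, hp⟩ := mem_iUnion₂.1 (hF (mem_univ p))
  exact ⟨q, by simpa using hq, by rw [dist_comm]; exact hp⟩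

/-- Two points of equal direction are moved by the same translation, so their distance is constant
in time and a net of the torus serves for all times. -/
theorem exists_finset_fiber_cover (v : Circle) {r : ℝ} (hr : 0 < r) :
    ∃ F : Finset UnitTangentTorus, {x : UnitTangentTorus | x.2 = v} ⊆
      ⋃ x ∈ F, {y | ∀ t, dist (geodesicFlow t x) (geodesicFlow t y) < r} := by
  classical
  obtain ⟨F, hF⟩ := exists_finset_torus_cover hr
  refine ⟨F.image fun q => (q, v), fun y (hy : y.2 = v) => ?_⟩
  obtain ⟨q, hq, hlt⟩ := hF y.1
  refine mem_iUnion₂.2 ⟨(q, v), Finset.mem_image_of_mem _ hq, fun t => ?_⟩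
  refine (dist_geodesicFlow_le t _ _).trans_lt ?_
  simpa [hy] using hlt

/-- The `m`-th roots of unity work: round the angle down and bound the chord by the arc. -/
theorem exists_finset_circle_cover {m : ℕ} (hm : 0 < m) :
    ∃ F : Finset Circle, F.card ≤ m ∧ ∀ v, ∃ w ∈ F, dist w v ≤ 2 * Real.pi / m := by
  classical
  refine ⟨(Finset.range m).image fun i : ℕ => Circle.exp (2 * Real.pi / m * i),
    Finset.card_image_le.trans (by simp), fun v => ?_⟩
  obtain ⟨θ, hθ0, hθ, rfl⟩ : ∃ θ, 0 ≤ θ ∧ θ < 2 * Real.pi ∧ Circle.exp θ = v := by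
    refine ⟨toIcoMod Real.two_pi_pos 0 (Complex.arg v), (toIcoMod_mem_Ico' _ _).1,
      (toIcoMod_mem_Ico' _ _).2, ?_⟩
    rw [toIcoMod, zsmul_eq_mul, Circle.exp_sub, Circle.exp_arg]
    simp
  have hm' : (0 : ℝ) < m := by exact_mod_cast hm
  set d : ℝ := 2 * Real.pi / m with hd
  have hd0 : 0 < d := by positivity
  have hfl := Nat.floor_le (show 0 ≤ θ / d by positivity)
  have hfl' := Nat.lt_floor_add_one (θ / d)
  refine ⟨_, Finset.mem_image_of_mem _ (Finset.mem_range.2 (?_ : ⌊θ / d⌋₊ < m)), ?_⟩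
  · refine (Nat.floor_lt (by positivity)).2 ?_
    rw [div_lt_iff₀ hd0, hd, mul_div_cancel₀ _ hm'.ne']
    exact hθ
  · rw [le_div_iff₀ hd0] at hfl
    rw [div_lt_iff₀ hd0] at hfl'
    have h1 : dist (Circle.exp (d * ⌊θ / d⌋₊)) (Circle.exp θ) ≤ |d * ⌊θ / d⌋₊ - θ| := by
      have h2 : (Circle.exp (d * ⌊θ / d⌋₊) : ℂ) - Circle.exp θ =
          Circle.exp θ * (Complex.exp (Complex.I * ((d * ⌊θ / d⌋₊ - θ : ℝ) : ℂ)) - 1) := by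
        rw [mul_sub, Circle.coe_exp, Circle.coe_exp, ← Complex.exp_add]
        congr 2
        · push_cast; ring
        · ring
      rw [circle_dist_eq, h2, norm_mul, Circle.norm_coe, one_mul]
      exact Real.norm_exp_I_mul_ofReal_sub_one_le
    refine h1.trans ?_
    rw [abs_le]
    constructor <;> nlinarith

/-- Covering of the unit tangent bundle by linearly many Bowen balls. -/
theorem exists_finset_bowen_cover {r : ℝ} (hr : 0 < r) :
    ∃ C : ℝ, 0 ≤ C ∧ ∀ T : ℝ, 1 ≤ T → ∃ F : Finset UnitTangentTorus, (F.card : ℝ) ≤ C * T ∧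
      univ ⊆ ⋃ x ∈ F, {y | ∀ t, |t| ≤ T → dist (geodesicFlow t x) (geodesicFlow t y) < r} := by
  classical
  obtain ⟨A, hA⟩ := exists_finset_torus_cover (half_pos hr)
  -- Half of `r` is spent on the base point. For the direction, `|t| + 1 ≤ 2 T` because `T ≥ 1`, and
  -- `m > 8 π T / r` makes `2 T · 2 π / m < r / 2`.
  refine ⟨A.card * (8 * Real.pi / r + 1), by positivity, fun T hT => ?_⟩
  obtain ⟨m, hm1, hm2⟩ : ∃ m : ℕ, 8 * Real.pi / r * T < m ∧ (m : ℝ) ≤ (8 * Real.pi / r + 1) * T := by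
    refine ⟨⌊8 * Real.pi / r * T⌋₊ + 1, by exact_mod_cast Nat.lt_floor_add_one _, ?_⟩
    push_cast
    have := Nat.floor_le (show 0 ≤ 8 * Real.pi / r * T by positivity)
    linarith
  have hm0 : (0 : ℝ) < m := lt_trans (by positivity) hm1
  obtain ⟨B, hB, hBc⟩ := exists_finset_circle_cover (m := m) (by exact_mod_cast hm0)
  refine ⟨A ×ˢ B, ?_, fun y _ => ?_⟩
  · rw [Finset.card_product]
    push_cast
    calc (A.card : ℝ) * B.card ≤ A.card * m := by gcongr
      _ ≤ A.card * ((8 * Real.pi / r + 1) * T) := by gcongr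
      _ = _ := by ring
  · obtain ⟨q, hq, hqy⟩ := hA y.1
    obtain ⟨w, hw, hwy⟩ := hBc y.2
    refine mem_iUnion₂.2 ⟨(q, w), Finset.mk_mem_product hq hw, fun t ht => ?_⟩
    refine (dist_geodesicFlow_le t _ _).trans_lt ?_
    dsimp only
    have h1 : 2 * T * (2 * Real.pi / m) < r / 2 := by
      rw [mul_div_assoc', div_lt_iff₀ hm0]
      rw [div_mul_eq_mul_div, div_lt_iff₀ hr] at hm1
      linarith
    have h2 : (|t| + 1) * dist w y.2 ≤ 2 * T * (2 * Real.pi / m) := by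
      gcongr
      linarith
    linarith

/-! ### Upper bounds for the topological slow entropy -/

theorem flowTopSlowEntropy_geodesicFlow_le :
    flowTopSlowEntropy geodesicFlow polyScaleReal ≤ 1 := by
  refine iSup₂_le fun K _ => ?_
  refine limsup_le_of_le (h := eventually_nhdsWithin_of_forall fun ε (hε : 0 < ε) => ?_)
  obtain ⟨C, -, hC⟩ := exists_finset_bowen_cover hε
  refine growthRate_rpow_le_one (u := id) tendsto_id (C := C) ?_
  filter_upwards [eventually_ge_atTop 1] with T hT
  obtain ⟨F, hcard, hF⟩ := hC T hT
  refine (iInf₂_le F fun y hy => ?_).trans ?_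
  · obtain ⟨x, hx, hxy⟩ := mem_iUnion₂.1 (hF (mem_univ y))
    refine mem_iUnion₂.2 ⟨x, hx, fun t ht => hxy t ?_⟩
    rw [abs_of_nonneg ht.1]; exact ht.2
  · rw [← ENNReal.ofReal_natCast]
    exact ENNReal.ofReal_le_ofReal hcard

theorem topSlowEntropy_geodesicFlow_le (s : ℝ) :
    topSlowEntropy (geodesicFlow s) polyScale ≤ 1 := by
  refine iSup₂_le fun K _ => ?_
  refine limsup_le_of_le (h := eventually_nhdsWithin_of_forall fun ε (hε : 0 < ε) => ?_)
  obtain ⟨C, hC0, hC⟩ := exists_finset_bowen_cover hε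
  refine growthRate_rpow_le_one (u := fun n : ℕ => (n : ℝ)) tendsto_natCast_atTop_atTop
    (C := C * (|s| + 1)) ?_
  filter_upwards [eventually_ge_atTop 1] with n hn
  have hn' : (1 : ℝ) ≤ n := by exact_mod_cast hn
  -- The summand `1` keeps the time horizon at least `1` even when `|s|` is small.
  obtain ⟨F, hcard, hF⟩ := hC ((|s| + 1) * n) (by nlinarith [abs_nonneg s])
  refine (iInf₂_le F fun y hy => ?_).trans ?_
  · obtain ⟨x, hx, hxy⟩ := mem_iUnion₂.1 (hF (mem_univ y))
    refine mem_iUnion₂.2 ⟨x, hx, fun i hi => ?_⟩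
    rw [flow_iterate, flow_iterate]
    refine hxy _ ?_
    have hi' : (i : ℝ) ≤ n := by exact_mod_cast hi.le
    rw [abs_mul, Nat.abs_cast, mul_comm]
    have := abs_nonneg s
    gcongr
    linarith
  · rw [← ENNReal.ofReal_natCast]
    exact ENNReal.ofReal_le_ofReal (by linarith)


/-! ### The Haar measures of the circle and of the unit tangent bundle -/

instance : IsProbabilityMeasure (volume : Measure UnitAddCircle) :=
  ⟨by simp⟩

instance : (volume : Measure Torus).IsAddHaarMeasure := by
  rw [Measure.volume_eq_prod]; infer_instance

/-- The image measure is an invariant probability because `AddCircle.toCircle` is a surjective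
homomorphism; Haar measure is unique. This gives directions a real parameter. -/
theorem circleHaar_eq_map :
    circleHaar = (volume : Measure UnitAddCircle).map AddCircle.toCircle := by
  set ρ : Measure Circle := (volume : Measure UnitAddCircle).map AddCircle.toCircle with hρ
  have hm : Measurable (AddCircle.toCircle : UnitAddCircle → Circle) :=
    AddCircle.continuous_toCircle.measurable
  have hinv : ρ.IsMulLeftInvariant := by
    refine ⟨fun z => ?_⟩
    obtain ⟨a, rfl⟩ : ∃ a : UnitAddCircle, AddCircle.toCircle a = z :=
      ⟨(AddCircle.homeomorphCircle one_ne_zero).symm z, by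
        rw [← AddCircle.homeomorphCircle_apply one_ne_zero, Homeomorph.apply_symm_apply]⟩
    rw [hρ, Measure.map_map (measurable_const_mul _) hm]
    have h : (fun x => AddCircle.toCircle a * x) ∘ (AddCircle.toCircle : UnitAddCircle → Circle) =
        AddCircle.toCircle ∘ fun x => a + x := by
      ext x; simp [AddCircle.toCircle_add]
    rw [h, ← Measure.map_map hm (measurable_const_add a), map_add_left_eq_self]
  have hprob : IsProbabilityMeasure ρ := Measure.isProbabilityMeasure_map hm.aemeasurable
  have h := Measure.haarMeasure_unique ρ ⊤
  rw [h]
  simp [circleHaar]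

instance : IsProbabilityMeasure circleHaar := by
  rw [circleHaar_eq_map]
  exact Measure.isProbabilityMeasure_map AddCircle.continuous_toCircle.measurable.aemeasurable

instance : IsProbabilityMeasure unitTangentHaar := by
  unfold unitTangentHaar; infer_instance

/-- Only the upper half circle is parametrized, where the sine is a nonnegative weight. The
inequality is applied to the set of uncovered directions. -/
theorem volume_circleExp_le {A : Set Circle} (hA : MeasurableSet A) :
    (volume.restrict (Ioc (0 : ℝ) (1 / 2))) {x : ℝ | Circle.exp (2 * Real.pi * x) ∈ A} ≤
      circleHaar A := by
  have hm : Measurable (AddCircle.toCircle : UnitAddCircle → Circle) :=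
    AddCircle.continuous_toCircle.measurable
  have h := (UnitAddCircle.measurePreserving_mk 0)
  rw [circleHaar_eq_map, Measure.map_apply hm hA,
    ← h.measure_preimage (hm hA).nullMeasurableSet]
  have h2 : {x : ℝ | Circle.exp (2 * Real.pi * x) ∈ A} =
      (fun x : ℝ => (x : UnitAddCircle)) ⁻¹' (AddCircle.toCircle ⁻¹' A) := by
    ext x
    simp [AddCircle.toCircle_apply_mk]
  rw [h2]
  exact Measure.restrict_mono (Ioc_subset_Ioc le_rfl (by norm_num)) le_rfl _

theorem measurePreserving_geodesicFlow (t : ℝ) :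
    MeasurePreserving (geodesicFlow t) unitTangentHaar unitTangentHaar := by
  have hm : Measurable (geodesicFlow t) := (geodesicFlow.continuous_toFun t).measurable
  refine ⟨hm, Measure.ext fun A hA => ?_⟩
  rw [Measure.map_apply hm hA, unitTangentHaar, Measure.prod_apply_symm (hm hA),
    Measure.prod_apply_symm hA]
  refine lintegral_congr fun v => ?_
  rw [← measure_preimage_add (volume : Measure Torus) (torusProj (t * (v : ℂ)))
    ((fun p => (p, v)) ⁻¹' A)]
  congr 1
  ext p
  simp [geodesicFlow_apply, add_comm]

/-! ### An oscillatory integral -/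

/-- `∫ e(a Re v) (Im v)⁺ dv`, up to normalization. -/
noncomputable def oscKernel (a : ℝ) : ℂ :=
  ∫ x in Ioc (0 : ℝ) (1 / 2), (Real.sin (2 * Real.pi * x) : ℂ) *
    Complex.exp (2 * Real.pi * Complex.I * a * Real.cos (2 * Real.pi * x))

theorem norm_cexp_two_pi_mul (a b : ℝ) :
    ‖Complex.exp (2 * Real.pi * Complex.I * a * b)‖ = 1 := by
  rw [show (2 * Real.pi * Complex.I * a * b : ℂ) = ((2 * Real.pi * a * b : ℝ) : ℂ) * Complex.I by
    push_cast; ring]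
  exact Complex.norm_exp_ofReal_mul_I _

theorem norm_oscKernel_le_one (a : ℝ) : ‖oscKernel a‖ ≤ 1 := by
  refine (norm_setIntegral_le_of_norm_le_const (C := 1) (by simp) fun x _ => ?_).trans ?_
  · rw [norm_mul, norm_cexp_two_pi_mul, mul_one, Complex.norm_real, Real.norm_eq_abs]
    exact Real.abs_sin_le_one _
  · rw [Measure.real, Real.volume_Ioc, ENNReal.toReal_ofReal] <;> norm_num

/-- The weight `sin` is, up to a constant, the derivative of the phase `cos`, so the integrand is an
exact derivative and only boundary terms, of total size at most `2`, remain. Without the weight, the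
stationary points at the two ends would reduce the decay to `|a| ^ (-1/2)`. -/
theorem abs_mul_norm_oscKernel_le_one (a : ℝ) : |a| * ‖oscKernel a‖ ≤ 1 := by
  have hpi := Real.pi_pos
  set c : ℂ := 2 * Real.pi * Complex.I * a with hc
  set Φ : ℝ → ℂ := fun x => Complex.exp (c * Real.cos (2 * Real.pi * x)) with hΦ
  have hderiv : ∀ x : ℝ, HasDerivAt Φ (-(2 * Real.pi * c) *
      ((Real.sin (2 * Real.pi * x) : ℂ) * Complex.exp (c * Real.cos (2 * Real.pi * x)))) x := by
    intro x
    have h1 : HasDerivAt (fun x : ℝ => Real.cos (2 * Real.pi * x))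
        (-Real.sin (2 * Real.pi * x) * (2 * Real.pi)) x := by
      have := (hasDerivAt_id x).const_mul (2 * Real.pi)
      simpa using this.cos
    have h2 := ((h1.ofReal_comp).const_mul c).cexp
    refine h2.congr_deriv ?_
    push_cast
    ring
  have hint : ∫ x in (0 : ℝ)..(1 / 2), -(2 * Real.pi * c) *
      ((Real.sin (2 * Real.pi * x) : ℂ) * Complex.exp (c * Real.cos (2 * Real.pi * x))) =
      Φ (1 / 2) - Φ 0 := by
    refine intervalIntegral.integral_eq_sub_of_hasDerivAt (fun x _ => hderiv x) ?_
    exact Continuous.intervalIntegrable (by fun_prop) _ _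
  rw [intervalIntegral.integral_const_mul, intervalIntegral.integral_of_le (by norm_num)] at hint
  have hnorm : ‖(2 * Real.pi * c : ℂ)‖ = 4 * Real.pi ^ 2 * |a| := by
    simp only [hc, norm_mul, Complex.norm_real, Complex.norm_I, Real.norm_eq_abs,
      Complex.norm_ofNat, abs_of_pos hpi]
    ring
  have h1 : 4 * Real.pi ^ 2 * |a| * ‖oscKernel a‖ ≤ 2 := by
    rw [← hnorm, ← norm_neg (2 * Real.pi * c : ℂ), ← norm_mul]
    rw [show -(2 * Real.pi * c : ℂ) * oscKernel a = Φ (1 / 2) - Φ 0 from hint]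
    refine (norm_sub_le _ _).trans ?_
    simp only [hΦ, hc, norm_cexp_two_pi_mul]
    norm_num
  have h2 : 2 * (|a| * ‖oscKernel a‖) ≤ 4 * Real.pi ^ 2 * |a| * ‖oscKernel a‖ := by
    have : (0 : ℝ) ≤ |a| * ‖oscKernel a‖ := by positivity
    have hpi2 : 2 ≤ 4 * Real.pi ^ 2 := by nlinarith [Real.pi_gt_three]
    calc 2 * (|a| * ‖oscKernel a‖) ≤ 4 * Real.pi ^ 2 * (|a| * ‖oscKernel a‖) := by gcongr
      _ = _ := by ring
  linarith

/-- A step function that dominates `min(1, 1 / |a|)`. -/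
noncomputable def dyadicKernel (J : ℕ) (a : ℝ) : ℝ :=
  ∑ j ∈ Finset.range J, 2 * (2⁻¹ : ℝ) ^ j * (Metric.closedBall (0 : ℝ) (2 ^ j)).indicator 1 a +
    2 * (2⁻¹ : ℝ) ^ J

theorem dyadicKernel_nonneg (J : ℕ) (a : ℝ) : 0 ≤ dyadicKernel J a := by
  refine add_nonneg (Finset.sum_nonneg fun j _ => mul_nonneg (by positivity) ?_) (by positivity)
  exact indicator_nonneg (by simp) _

/-- Induction on `J`: passing to `J + 1` lowers the constant term by `2⁻¹ ^ J`. If `|a| ≤ 2 ^ J` the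
new indicator compensates; otherwise `κ ≤ 2⁻¹ ^ J`, which the remaining constant covers. -/
theorem le_dyadicKernel {a κ : ℝ} (h1 : κ ≤ 1) (h2 : |a| * κ ≤ 1) (J : ℕ) :
    κ ≤ dyadicKernel J a := by
  induction J with
  | zero => simp [dyadicKernel]; linarith
  | succ J ih =>
    have hstep : dyadicKernel (J + 1) a = dyadicKernel J a +
        2 * (2⁻¹ : ℝ) ^ J * (Metric.closedBall (0 : ℝ) (2 ^ J)).indicator 1 a -
          (2⁻¹ : ℝ) ^ J := by
      rw [dyadicKernel, dyadicKernel, Finset.sum_range_succ, pow_succ]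
      ring
    have hp : (0 : ℝ) < 2⁻¹ ^ J := by positivity
    by_cases ha : a ∈ Metric.closedBall (0 : ℝ) (2 ^ J)
    · rw [hstep, indicator_of_mem ha, Pi.one_apply]
      linarith
    · have h0 : 0 ≤ ∑ j ∈ Finset.range (J + 1),
          2 * (2⁻¹ : ℝ) ^ j * (Metric.closedBall (0 : ℝ) (2 ^ j)).indicator 1 a :=
        Finset.sum_nonneg fun j _ => mul_nonneg (by positivity) (indicator_nonneg (by simp) _)
      have h3 : (2 : ℝ) ^ J < |a| := by simpa using ha
      have h4 : κ ≤ 2⁻¹ ^ J := by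
        by_contra! hlt
        have h5 : (2 : ℝ) ^ J * 2⁻¹ ^ J = 1 := by rw [← mul_pow]; norm_num
        have h6 : (2 : ℝ) ^ J * 2⁻¹ ^ J < |a| * κ := by gcongr
        linarith
      rw [dyadicKernel, pow_succ]
      linarith

theorem norm_oscKernel_le (J : ℕ) (a : ℝ) : ‖oscKernel a‖ ≤ dyadicKernel J a :=
  le_dyadicKernel (norm_oscKernel_le_one a) (abs_mul_norm_oscKernel_le_one a) J

theorem measurable_dyadicKernel (J : ℕ) : Measurable (dyadicKernel J) := by
  unfold dyadicKernel
  refine Measurable.add_const (Finset.measurable_sum _ fun j _ => ?_) _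
  exact (measurable_one.indicator Metric.isClosed_closedBall.measurableSet).const_mul _

theorem dyadicKernel_le (J : ℕ) (a : ℝ) : dyadicKernel J a ≤ 2 * J + 2 := by
  refine add_le_add ((Finset.sum_le_sum (g := fun _ => (2 : ℝ)) fun j _ => ?_).trans ?_) ?_
  · have h1 : (2⁻¹ : ℝ) ^ j ≤ 1 := pow_le_one₀ (by norm_num) (by norm_num)
    have h2 : (Metric.closedBall (0 : ℝ) (2 ^ j)).indicator (1 : ℝ → ℝ) a ≤ 1 :=
      indicator_le_self' (by simp) _
    have h3 : 0 ≤ (Metric.closedBall (0 : ℝ) (2 ^ j)).indicator (1 : ℝ → ℝ) a :=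
      indicator_nonneg (by simp) _
    have h4 : (0 : ℝ) ≤ 2⁻¹ ^ j := by positivity
    nlinarith
  · simp [mul_comm]
  · have h1 : (2⁻¹ : ℝ) ^ J ≤ 1 := pow_le_one₀ (by norm_num) (by norm_num)
    linarith

/-- Each of the `J` dyadic balls contributes at most `2 C / 2 ^ J`, which is the source of the
logarithm. A step kernel needs only the measures of balls, so discrete and continuous times are
treated alike. -/
theorem integral_dyadicKernel_le (τ : Measure ℝ) [IsProbabilityMeasure τ] {C : ℝ} {J : ℕ}
    (hτ : ∀ s r : ℝ, 1 ≤ r → τ.real (Metric.closedBall s r) ≤ C * r / 2 ^ J) (s : ℝ) :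
    ∫ t, dyadicKernel J (t - s) ∂τ ≤ 2 * (C * J + 1) / 2 ^ J := by
  have hind : ∀ j : ℕ, (fun t : ℝ => 2 * (2⁻¹ : ℝ) ^ j *
      (Metric.closedBall (0 : ℝ) (2 ^ j)).indicator 1 (t - s)) =
      (Metric.closedBall s (2 ^ j)).indicator fun _ => 2 * (2⁻¹ : ℝ) ^ j := by
    intro j
    ext t
    by_cases h : |t - s| ≤ 2 ^ j <;> simp [indicator, Real.dist_eq, h]
  have hI : ∀ j : ℕ, Integrable (fun t : ℝ => 2 * (2⁻¹ : ℝ) ^ j *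
      (Metric.closedBall (0 : ℝ) (2 ^ j)).indicator 1 (t - s)) τ := fun j => by
    rw [hind]
    exact (integrable_const _).indicator Metric.isClosed_closedBall.measurableSet
  unfold dyadicKernel
  rw [integral_add (integrable_finsetSum _ fun j _ => hI j) (integrable_const _),
    integral_finsetSum _ fun j _ => hI j]
  have hterm : ∀ j ∈ Finset.range J, ∫ t, 2 * (2⁻¹ : ℝ) ^ j *
      (Metric.closedBall (0 : ℝ) (2 ^ j)).indicator 1 (t - s) ∂τ ≤ 2 * C / 2 ^ J := by
    intro j _
    rw [hind, integral_indicator_const _ Metric.isClosed_closedBall.measurableSet, smul_eq_mul]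
    have h1 := hτ s (2 ^ j) (one_le_pow₀ (by norm_num))
    have h5 : (2 : ℝ) ^ j * 2⁻¹ ^ j = 1 := by rw [← mul_pow]; norm_num
    calc τ.real (Metric.closedBall s (2 ^ j)) * (2 * 2⁻¹ ^ j)
        ≤ C * 2 ^ j / 2 ^ J * (2 * 2⁻¹ ^ j) := by gcongr
      _ = 2 * C / 2 ^ J * (2 ^ j * 2⁻¹ ^ j) := by ring
      _ = _ := by rw [h5, mul_one]
  refine (add_le_add (Finset.sum_le_sum hterm) le_rfl).trans (le_of_eq ?_)
  simp only [Finset.sum_const, Finset.card_range, nsmul_eq_mul, integral_const,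
    probReal_univ, smul_eq_mul, one_mul, inv_pow]
  field_simp

/-- The correlation of the coded orbit `b` with the rotation of speed `u`. -/
noncomputable def correlation (τ : Measure ℝ) (b : ℝ → ℂ) (u : ℝ) : ℂ :=
  ∫ t, Complex.exp (2 * Real.pi * Complex.I * t * u) * b t ∂τ

theorem continuous_correlation (τ : Measure ℝ) [IsProbabilityMeasure τ] {b : ℝ → ℂ}
    (hb : Measurable b) (hb2 : ∀ t, ‖b t‖ ≤ 2) : Continuous (correlation τ b) := by
  refine continuous_of_dominated (bound := fun _ => 2) (fun u => ?_) (fun u => ?_)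
    (integrable_const _) (Eventually.of_forall fun t => by fun_prop)
  · exact ((Continuous.measurable (by fun_prop)).mul hb).aestronglyMeasurable
  · refine Eventually.of_forall fun t => ?_
    rw [norm_mul, norm_cexp_two_pi_mul, one_mul]
    exact hb2 t

/-- A large sieve argument: write the square as a double integral over times and integrate over the
angle first. The angular integral is `oscKernel` of the time difference; the factor `4` bounds the
product of two code values. -/
theorem integral_norm_correlation_sq_le (τ : Measure ℝ) [IsProbabilityMeasure τ] {b : ℝ → ℂ}
    (hb : Measurable b) (hb2 : ∀ t, ‖b t‖ ≤ 2) {J : ℕ} {M : ℝ}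
    (hM : ∀ s, ∫ t, dyadicKernel J (t - s) ∂τ ≤ M) :
    ∫ x in Ioc (0 : ℝ) (1 / 2), Real.sin (2 * Real.pi * x) *
      ‖correlation τ b (Real.cos (2 * Real.pi * x))‖ ^ 2 ≤ 4 * M := by
  set σ : Measure ℝ := volume.restrict (Ioc (0 : ℝ) (1 / 2)) with hσ
  have hσfin : IsFiniteMeasure σ := ⟨by simp [hσ]⟩
  set g : ℝ → ℝ → ℂ := fun u t => Complex.exp (2 * Real.pi * Complex.I * t * u) * b t with hg
  have hsq : ∀ x : ℝ, ((Real.sin (2 * Real.pi * x) *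
      ‖correlation τ b (Real.cos (2 * Real.pi * x))‖ ^ 2 : ℝ) : ℂ) =
      ∫ p : ℝ × ℝ, (Real.sin (2 * Real.pi * x) : ℂ) * (g (Real.cos (2 * Real.pi * x)) p.1 *
        (starRingEnd ℂ) (g (Real.cos (2 * Real.pi * x)) p.2)) ∂τ.prod τ := by
    intro x
    rw [integral_const_mul, integral_prod_mul (g (Real.cos (2 * Real.pi * x)))
      (fun t => (starRingEnd ℂ) (g (Real.cos (2 * Real.pi * x)) t)), integral_conj,
      Complex.mul_conj, Complex.normSq_eq_norm_sq]
    push_cast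
    rfl
  have hexp : ∀ (x : ℝ) (p : ℝ × ℝ), (Real.sin (2 * Real.pi * x) : ℂ) *
      (g (Real.cos (2 * Real.pi * x)) p.1 *
        (starRingEnd ℂ) (g (Real.cos (2 * Real.pi * x)) p.2)) =
      b p.1 * (starRingEnd ℂ) (b p.2) * ((Real.sin (2 * Real.pi * x) : ℂ) *
        Complex.exp (2 * Real.pi * Complex.I * (p.1 - p.2 : ℝ) * Real.cos (2 * Real.pi * x))) := by
    intro x p
    simp only [hg, map_mul, ← Complex.exp_conj, Complex.conj_ofReal, Complex.conj_I, map_ofNat]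
    rw [show (2 * Real.pi * Complex.I * (p.1 - p.2 : ℝ) * Real.cos (2 * Real.pi * x) : ℂ) =
      2 * Real.pi * Complex.I * p.1 * Real.cos (2 * Real.pi * x) +
        2 * Real.pi * -Complex.I * p.2 * Real.cos (2 * Real.pi * x) by push_cast; ring,
      Complex.exp_add]
    ring
  have hnorm : ∀ p : ℝ × ℝ, ‖b p.1 * (starRingEnd ℂ) (b p.2)‖ ≤ 4 := by
    intro p
    rw [norm_mul, RCLike.norm_conj]
    nlinarith [hb2 p.1, hb2 p.2, norm_nonneg (b p.1), norm_nonneg (b p.2)]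
  have hint : Integrable (Function.uncurry fun (x : ℝ) (p : ℝ × ℝ) =>
      b p.1 * (starRingEnd ℂ) (b p.2) * ((Real.sin (2 * Real.pi * x) : ℂ) *
        Complex.exp (2 * Real.pi * Complex.I * (p.1 - p.2 : ℝ) * Real.cos (2 * Real.pi * x))))
      (σ.prod (τ.prod τ)) := by
    refine Integrable.of_bound (Measurable.aestronglyMeasurable ?_) 4
      (Eventually.of_forall fun q => ?_)
    · refine Measurable.mul ?_ (Continuous.measurable (by fun_prop))
      exact (hb.comp (by fun_prop)).mul
        (Complex.continuous_conj.measurable.comp (hb.comp (by fun_prop)))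
    · simp only [Function.uncurry]
      rw [norm_mul, norm_mul (Complex.ofReal _), norm_cexp_two_pi_mul, mul_one, Complex.norm_real,
        Real.norm_eq_abs]
      nlinarith [hnorm q.2, Real.abs_sin_le_one (2 * Real.pi * q.1),
        abs_nonneg (Real.sin (2 * Real.pi * q.1)), norm_nonneg (b q.2.1 * (starRingEnd ℂ) (b q.2.2))]
  -- Fubini brings the angular integral inside and turns it into `oscKernel`.
  have hkey : ((∫ x, Real.sin (2 * Real.pi * x) *
      ‖correlation τ b (Real.cos (2 * Real.pi * x))‖ ^ 2 ∂σ : ℝ) : ℂ) =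
      ∫ p : ℝ × ℝ, b p.1 * (starRingEnd ℂ) (b p.2) * oscKernel (p.1 - p.2) ∂τ.prod τ := by
    rw [← integral_complex_ofReal]
    calc _ = ∫ x, ∫ p : ℝ × ℝ, b p.1 * (starRingEnd ℂ) (b p.2) *
          ((Real.sin (2 * Real.pi * x) : ℂ) * Complex.exp (2 * Real.pi * Complex.I *
            (p.1 - p.2 : ℝ) * Real.cos (2 * Real.pi * x))) ∂τ.prod τ ∂σ := by
            refine integral_congr_ae (Eventually.of_forall fun x => ?_)
            refine (hsq x).trans (integral_congr_ae (Eventually.of_forall fun p => hexp x p))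
      _ = _ := by
            rw [integral_integral_swap hint]
            refine integral_congr_ae (Eventually.of_forall fun p => ?_)
            exact integral_const_mul _ _
  have hdy : Measurable fun p : ℝ × ℝ => dyadicKernel J (p.1 - p.2) :=
    (measurable_dyadicKernel J).comp (by fun_prop)
  have hdyI : Integrable (fun p : ℝ × ℝ => dyadicKernel J (p.1 - p.2)) (τ.prod τ) := by
    refine Integrable.of_bound hdy.aestronglyMeasurable (2 * J + 2)
      (Eventually.of_forall fun p => ?_)
    rw [Real.norm_of_nonneg (dyadicKernel_nonneg _ _)]
    exact dyadicKernel_le _ _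
  calc ∫ x, Real.sin (2 * Real.pi * x) *
        ‖correlation τ b (Real.cos (2 * Real.pi * x))‖ ^ 2 ∂σ
      ≤ ‖((∫ x, Real.sin (2 * Real.pi * x) *
        ‖correlation τ b (Real.cos (2 * Real.pi * x))‖ ^ 2 ∂σ : ℝ) : ℂ)‖ := by
        rw [Complex.norm_real]; exact le_abs_self _
    _ ≤ ∫ p : ℝ × ℝ, 4 * dyadicKernel J (p.1 - p.2) ∂τ.prod τ := by
        rw [hkey]
        refine norm_integral_le_of_norm_le (hdyI.const_mul 4) (Eventually.of_forall fun p => ?_)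
        rw [norm_mul]
        exact mul_le_mul (hnorm p) (norm_oscKernel_le J _) (norm_nonneg _) (by norm_num)
    _ = 4 * ∫ s, ∫ t, dyadicKernel J (t - s) ∂τ ∂τ := by
        rw [integral_const_mul, integral_prod_symm _ hdyI]
    _ ≤ 4 * ∫ _s, M ∂τ := by
        gcongr
        · exact hdyI.integral_prod_right
        · exact integrable_const _
        · exact fun s => hM s
    _ = 4 * M := by simp


/-! ### The quadrant coding -/

open scoped Classical in
/-- The quadrant of the complex plane that contains `z`. -/
noncomputable def quadrant (z : ℂ) : Fin 4 :=
  if 0 ≤ z.re then (if 0 ≤ z.im then 0 else 1) else (if 0 ≤ z.im then 2 else 3)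

/-- The complex conjugate of a diagonal vector of each quadrant. -/
noncomputable def quadrantCode (j : Fin 4) : ℂ :=
  if j = 0 then 1 - Complex.I else if j = 1 then 1 + Complex.I else
    if j = 2 then -1 - Complex.I else -1 + Complex.I

theorem measurable_quadrant : Measurable quadrant := by
  unfold quadrant
  refine Measurable.ite (measurableSet_le measurable_const Complex.measurable_re) ?_ ?_ <;>
  exact Measurable.ite (measurableSet_le measurable_const Complex.measurable_im)
    measurable_const measurable_const

theorem norm_quadrantCode_le (j : Fin 4) : ‖quadrantCode j‖ ≤ 2 := by
  have h1 : ‖(1 : ℂ)‖ + ‖Complex.I‖ = 2 := by norm_num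
  unfold quadrantCode
  split_ifs
  · exact (norm_sub_le _ _).trans h1.le
  · exact (norm_add_le _ _).trans h1.le
  · refine (norm_sub_le _ _).trans ?_
    rw [norm_neg]; exact h1.le
  · refine (norm_add_le _ _).trans ?_
    rw [norm_neg]; exact h1.le

/-- The real part equals `|Re z| + |Im z|`, which is at least the Euclidean norm. -/
theorem one_le_re_mul_quadrantCode {z : ℂ} (hz : ‖z‖ = 1) :
    1 ≤ (z * quadrantCode (quadrant z)).re := by
  have h0 : z.re ^ 2 + z.im ^ 2 = 1 := by
    have h := Complex.sq_norm z
    rw [hz, Complex.normSq_apply] at h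
    nlinarith
  have habs : 1 ≤ |z.re| + |z.im| := by
    have h1 := abs_nonneg z.re
    have h2 := abs_nonneg z.im
    nlinarith [sq_abs z.re, sq_abs z.im, mul_nonneg h1 h2]
  unfold quadrant
  split_ifs with h1 h2 h2 <;> simp only [quadrantCode] <;> norm_num
  · rw [abs_of_nonneg h1, abs_of_nonneg h2] at habs; linarith
  · rw [abs_of_nonneg h1, abs_of_nonpos (not_le.1 h2).le] at habs; linarith
  · rw [abs_of_nonpos (not_le.1 h1).le, abs_of_nonneg h2] at habs
    simp only [show (2 : Fin 4) ≠ 1 by decide, if_false]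
    simp
    linarith
  · rw [abs_of_nonpos (not_le.1 h1).le, abs_of_nonpos (not_le.1 h2).le] at habs
    simp only [show (3 : Fin 4) ≠ 1 by decide, show (3 : Fin 4) ≠ 2 by decide, if_false]
    simp
    linarith

/-- The character of the unit tangent bundle given by the first coordinate of the base point. -/
noncomputable def firstChar (x : UnitTangentTorus) : ℂ := AddCircle.toCircle x.1.1

/-- The partition of the unit tangent bundle into the quadrants of `firstChar`. -/
noncomputable def quadrantPartition (x : UnitTangentTorus) : Fin 4 := quadrant (firstChar x)

theorem circle_continuous_coe : Continuous fun v : Circle => (v : ℂ) := by fun_prop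

theorem continuous_firstChar : Continuous firstChar :=
  circle_continuous_coe.comp (AddCircle.continuous_toCircle.comp (by fun_prop))

theorem norm_firstChar (x : UnitTangentTorus) : ‖firstChar x‖ = 1 := Circle.norm_coe _

theorem measurable_quadrantPartition : Measurable quadrantPartition :=
  measurable_quadrant.comp continuous_firstChar.measurable

/-- Along an orbit the character is a pure exponential in time, whose frequency is the real part of
the direction; the base point enters only through a unimodular factor. -/
theorem firstChar_geodesicFlow (t : ℝ) (x : UnitTangentTorus) :
    firstChar (geodesicFlow t x) =
      firstChar x * Complex.exp (2 * Real.pi * Complex.I * t * (x.2 : ℂ).re) := by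
  rw [firstChar, geodesicFlow_apply, firstChar]
  simp only [torusProj, Prod.fst_add, AddCircle.toCircle_add, Circle.coe_mul,
    AddCircle.toCircle_apply_mk, Circle.coe_exp]
  congr 2
  rw [Complex.re_ofReal_mul]
  push_cast
  ring

/-- The code of the orbit of `x`, as a function of time. -/
noncomputable def orbitCode (x : UnitTangentTorus) (t : ℝ) : ℂ :=
  quadrantCode (quadrantPartition (geodesicFlow t x))

theorem measurable_orbitCode (x : UnitTangentTorus) : Measurable (orbitCode x) :=
  (measurable_of_finite quadrantCode).comp
    (measurable_quadrantPartition.comp (measurable_flow_left geodesicFlow x))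

theorem norm_orbitCode_le (x : UnitTangentTorus) (t : ℝ) : ‖orbitCode x t‖ ≤ 2 :=
  norm_quadrantCode_le _

/-- Points with similar codes have directions of large correlation. -/
theorem half_le_norm_correlation (τ : Measure ℝ) [IsProbabilityMeasure τ] {x y : UnitTangentTorus}
    (h : codeDist geodesicFlow τ quadrantPartition x y < 1 / 6) :
    1 / 2 ≤ ‖correlation τ (orbitCode x) (y.2 : ℂ).re‖ := by
  set A : Set ℝ :=
    {t | quadrantPartition (geodesicFlow t x) ≠ quadrantPartition (geodesicFlow t y)} with hA
  have hAm : MeasurableSet A := (measurableSet_eq_fun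
    (measurable_quadrantPartition.comp (measurable_flow_left geodesicFlow x))
    (measurable_quadrantPartition.comp (measurable_flow_left geodesicFlow y))).compl
  -- Where the codes agree the real part is at least `1`; elsewhere it is at least `-2 = 1 - 3`.
  -- Integrating gives `1 - 3 τ(A)`, and `τ(A) < 1 / 6` yields `1 / 2`.
  have hpt : ∀ t, 1 - A.indicator (fun _ => (3 : ℝ)) t ≤
      (firstChar (geodesicFlow t y) * orbitCode x t).re := by
    intro t
    by_cases ht : t ∈ A
    · rw [indicator_of_mem ht]
      have h1 := (abs_le.1 (Complex.abs_re_le_norm (firstChar (geodesicFlow t y) * orbitCode x t))).1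
      rw [norm_mul, norm_firstChar, one_mul] at h1
      linarith [norm_orbitCode_le x t]
    · rw [indicator_of_notMem ht, sub_zero, orbitCode, not_not.1 ht]
      exact one_le_re_mul_quadrantCode (norm_firstChar _)
  have hint : Integrable (fun t => firstChar (geodesicFlow t y) * orbitCode x t) τ := by
    refine Integrable.of_bound (Measurable.aestronglyMeasurable ?_) 2 (Eventually.of_forall ?_)
    · exact (continuous_firstChar.measurable.comp (measurable_flow_left geodesicFlow y)).mul
        (measurable_orbitCode x)
    · intro t
      rw [norm_mul, norm_firstChar, one_mul]
      exact norm_orbitCode_le x t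
  have heq : ∫ t, firstChar (geodesicFlow t y) * orbitCode x t ∂τ =
      firstChar y * correlation τ (orbitCode x) (y.2 : ℂ).re := by
    rw [correlation, ← integral_const_mul]
    refine integral_congr_ae (Eventually.of_forall fun t => ?_)
    simp only [firstChar_geodesicFlow, mul_assoc]
  have hlow : 1 - 3 * τ.real A ≤ (∫ t, firstChar (geodesicFlow t y) * orbitCode x t ∂τ).re := by
    have h1 : (∫ t, firstChar (geodesicFlow t y) * orbitCode x t ∂τ).re =
        ∫ t, (firstChar (geodesicFlow t y) * orbitCode x t).re ∂τ := (integral_re hint).symm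
    have h2 : ∫ t, (1 - A.indicator (fun _ => (3 : ℝ)) t) ∂τ = 1 - 3 * τ.real A := by
      rw [integral_sub (integrable_const _) ((integrable_const _).indicator hAm),
        integral_indicator_const _ hAm]
      simp [mul_comm]
    rw [h1, ← h2]
    exact integral_mono ((integrable_const _).sub ((integrable_const _).indicator hAm)) hint.re hpt
  have h1 : τ.real A < 1 / 6 := h
  have h2 := Complex.re_le_norm (∫ t, firstChar (geodesicFlow t y) * orbitCode x t ∂τ)
  rw [heq, norm_mul, norm_firstChar, one_mul] at h2
  rw [heq] at hlow
  linarith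

theorem integral_sin_two_pi : ∫ x in Ioc (0 : ℝ) (1 / 2), Real.sin (2 * Real.pi * x) =
    1 / Real.pi := by
  rw [← intervalIntegral.integral_of_le (by norm_num),
    intervalIntegral.integral_comp_mul_left (fun x => Real.sin x) (by positivity), integral_sin]
  rw [show 2 * Real.pi * (1 / 2) = Real.pi by ring]
  simp
  field_simp
  norm_num

/-- A family of Hamming balls that covers most of the unit tangent bundle is large. -/
theorem le_card_of_hamming_cover (τ : Measure ℝ) [IsProbabilityMeasure τ] {J : ℕ} {M : ℝ}
    (hM : ∀ s, ∫ t, dyadicKernel J (t - s) ∂τ ≤ M) {ε : ℝ} (hε : ε ≤ 1 / 6)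
    {F : Finset UnitTangentTorus}
    (hF : 1 - ε < unitTangentHaar.real
      (⋃ x ∈ F, {y | codeDist geodesicFlow τ quadrantPartition x y < ε})) :
    1 ≤ 160 * M * F.card := by
  set V : UnitTangentTorus → Set Circle := fun x =>
    {v | 1 / 2 ≤ ‖correlation τ (orbitCode x) (v : ℂ).re‖} with hV
  have hcont : ∀ x, Continuous (correlation τ (orbitCode x)) := fun x =>
    continuous_correlation τ (measurable_orbitCode x) (norm_orbitCode_le x)
  have hVc : ∀ x, IsClosed (V x) := fun x => isClosed_le continuous_const
    ((hcont x).comp (Complex.continuous_re.comp circle_continuous_coe)).norm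
  set A : Set Circle := ⋃ x ∈ F, V x with hA
  have hAm : MeasurableSet A := F.measurableSet_biUnion fun x _ => (hVc x).measurableSet
  -- Membership in a Hamming ball restricts the direction alone, so the union of balls lies over
  -- `A`.
  have hAμ : 1 - ε < circleHaar.real A := by
    refine hF.trans_le ?_
    have h1 : unitTangentHaar (univ ×ˢ A) = circleHaar A := by
      rw [unitTangentHaar, Measure.prod_prod, measure_univ, one_mul]
    rw [Measure.real, Measure.real, ← h1]
    refine ENNReal.toReal_mono (measure_ne_top _ _) (measure_mono ?_)
    refine iUnion₂_subset fun x hx y hy => ⟨mem_univ _, mem_iUnion₂.2 ⟨x, hx, ?_⟩⟩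
    exact half_le_norm_correlation τ (lt_of_lt_of_le hy hε)
  have hAc : circleHaar.real Aᶜ ≤ 1 / 6 := by
    rw [probReal_compl_eq_one_sub hAm]; linarith
  set σ : Measure ℝ := volume.restrict (Ioc (0 : ℝ) (1 / 2)) with hσ
  have hσfin : IsFiniteMeasure σ := ⟨by simp [hσ]⟩
  set B : Set ℝ := {x | Circle.exp (2 * Real.pi * x) ∈ Aᶜ} with hB
  have hBm : MeasurableSet B :=
    (Continuous.measurable (f := fun x : ℝ => Circle.exp (2 * Real.pi * x)) (by fun_prop)) hAm.compl
  have hBσ : σ.real B ≤ 1 / 6 := (ENNReal.toReal_mono (measure_ne_top _ _)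
    (volume_circleExp_le hAm.compl)).trans hAc
  set f : UnitTangentTorus → ℝ → ℝ := fun c x => Real.sin (2 * Real.pi * x) *
    ‖correlation τ (orbitCode c) (Real.cos (2 * Real.pi * x))‖ ^ 2 with hf
  have hfc : ∀ c, Continuous (f c) := fun c => by
    have := hcont c
    fun_prop
  have hfI : ∀ c, Integrable (f c) σ := fun c =>
    ((hfc c).integrableOn_Icc (a := 0) (b := 1 / 2)).mono_set Ioc_subset_Icc_self
  -- Over `A` some correlation is at least `1 / 2`, so four times its square is at least `1`; on `B`
  -- the indicator absorbs the sine.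
  have hpt : ∀ x ∈ Ioc (0 : ℝ) (1 / 2), Real.sin (2 * Real.pi * x) ≤
      ∑ c ∈ F, 4 * f c x + B.indicator (fun _ => (1 : ℝ)) x := by
    intro x hx
    have hsin : 0 ≤ Real.sin (2 * Real.pi * x) := by
      refine Real.sin_nonneg_of_nonneg_of_le_pi (by have := hx.1; positivity) ?_
      nlinarith [Real.pi_pos, hx.2]
    have hnn : ∀ c, 0 ≤ 4 * f c x := fun c => by positivity
    by_cases hxB : x ∈ B
    · rw [indicator_of_mem hxB]
      linarith [Real.sin_le_one (2 * Real.pi * x), Finset.sum_nonneg fun c (_ : c ∈ F) => hnn c]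
    · rw [indicator_of_notMem hxB, add_zero]
      have hxA : Circle.exp (2 * Real.pi * x) ∈ A := not_not.1 hxB
      obtain ⟨c, hc, hcx⟩ := mem_iUnion₂.1 hxA
      refine le_trans ?_ (Finset.single_le_sum (f := fun c => 4 * f c x) (fun c _ => hnn c) hc)
      have h1 : 1 / 2 ≤ ‖correlation τ (orbitCode c) (Real.cos (2 * Real.pi * x))‖ := by
        have h2 : ((Circle.exp (2 * Real.pi * x) : Circle) : ℂ).re = Real.cos (2 * Real.pi * x) := by
          rw [Circle.coe_exp, Complex.exp_ofReal_mul_I_re]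
        rw [← h2]; exact hcx
      have h2 : 1 ≤ 4 * ‖correlation τ (orbitCode c) (Real.cos (2 * Real.pi * x))‖ ^ 2 := by
        nlinarith
      simp only [hf]
      nlinarith
  have hI1 : Integrable (fun x => ∑ c ∈ F, 4 * f c x) σ :=
    integrable_finsetSum _ fun c _ => (hfI c).const_mul 4
  have hI2 : Integrable (B.indicator fun _ => (1 : ℝ)) σ := (integrable_const _).indicator hBm
  have hmain : ∫ x, Real.sin (2 * Real.pi * x) ∂σ ≤
      ∫ x, (∑ c ∈ F, 4 * f c x + B.indicator (fun _ => (1 : ℝ)) x) ∂σ := by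
    refine integral_mono_ae ?_ (hI1.add hI2) ?_
    · exact ((Continuous.integrableOn_Icc (f := fun x : ℝ => Real.sin (2 * Real.pi * x))
        (by fun_prop) (a := 0) (b := 1 / 2)).mono_set Ioc_subset_Icc_self)
    · exact (ae_restrict_mem measurableSet_Ioc).mono hpt
  rw [integral_sin_two_pi, integral_add hI1 hI2, integral_indicator_const _ hBm, smul_eq_mul,
    mul_one, integral_finsetSum _ fun c _ => (hfI c).const_mul 4] at hmain
  have hsum : ∑ c ∈ F, ∫ x, 4 * f c x ∂σ ≤ F.card * (16 * M) := by
    rw [← nsmul_eq_mul]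
    refine Finset.sum_le_card_nsmul _ _ _ fun c _ => ?_
    rw [integral_const_mul]
    linarith [integral_norm_correlation_sq_le τ (measurable_orbitCode c) (norm_orbitCode_le c) hM]
  -- The bookkeeping: `1 / π - 1 / 6 ≥ 4 / 15 - 1 / 6 = 1 / 10`, which must be at most `16 M` times
  -- the number of balls.
  have hpi : 4 / 15 ≤ 1 / Real.pi := by
    rw [div_le_div_iff₀ (by norm_num) Real.pi_pos]
    linarith [Real.pi_lt_d2]
  linarith

/-- The number of Hamming balls needed to cover, for distributions of times that are spread over
an interval of length comparable to `2 ^ J`. -/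
theorem ofReal_le_card_of_hamming_cover (τ : Measure ℝ) [IsProbabilityMeasure τ] {C : ℝ}
    (hC : 0 ≤ C) {J : ℕ}
    (hτ : ∀ s r : ℝ, 1 ≤ r → τ.real (Metric.closedBall s r) ≤ C * r / 2 ^ J)
    {ε : ℝ} (hε : ε ≤ 1 / 6) {F : Finset UnitTangentTorus}
    (hF : 1 - ε < unitTangentHaar.real
      (⋃ x ∈ F, {y | codeDist geodesicFlow τ quadrantPartition x y < ε})) :
    ENNReal.ofReal (1 / 320 * 2 ^ J / (C * J + 1)) ≤ (F.card : ℝ≥0∞) := by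
  have h := le_card_of_hamming_cover τ (integral_dyadicKernel_le τ hτ) hε hF
  rw [← ENNReal.ofReal_natCast]
  refine ENNReal.ofReal_le_ofReal ?_
  have hpos : 0 < C * J + 1 := by positivity
  have h2 : (0 : ℝ) < 2 ^ J := by positivity
  rw [div_le_iff₀ hpos]
  have h3 : 160 * (2 * (C * J + 1) / 2 ^ J) * (F.card : ℝ) * 2 ^ J = 320 * (F.card * (C * J + 1)) := by
    field_simp
    ring
  nlinarith

/-! ### Spread of the two distributions of times, and the values of the slow entropies -/

theorem uniformTime_closedBall_le {T : ℝ} (hT : 0 < T) (s : ℝ) {r : ℝ} (hr : 1 ≤ r) :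
    (uniformTime T).real (Metric.closedBall s r) ≤ 2 * r / T := by
  have h : (uniformTime T) (Metric.closedBall s r) ≤ ENNReal.ofReal (2 * r / T) := by
    rw [uniformTime, Measure.smul_apply, smul_eq_mul, ENNReal.ofReal_div_of_pos hT,
      ENNReal.div_eq_inv_mul, ← Real.volume_closedBall]
    gcongr
    exact Measure.restrict_le_self
  exact ENNReal.toReal_le_of_le_ofReal (by positivity) h

/-- The multiples of `s` are `|s|`-separated, so a ball of radius `r` contains at most `2 r / |s| +
1` of them. The condition `1 ≤ r` absorbs the last summand. -/
theorem discreteTime_closedBall_le {s : ℝ} (hs : s ≠ 0) {n : ℕ} (hn : 0 < n) (a : ℝ) {r : ℝ}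
    (hr : 1 ≤ r) :
    (discreteTime s n).real (Metric.closedBall a r) ≤ (2 / |s| + 1) * r / n := by
  classical
  rw [discreteTime_real]
  have hs' : 0 < |s| := abs_pos.2 hs
  refine div_le_div_of_nonneg_right ?_ (by positivity)
  set S := (Finset.range n).filter fun i : ℕ => (i : ℝ) * s ∈ Metric.closedBall a r with hS
  have hpos : 0 ≤ (2 / |s| + 1) * r := by positivity
  rcases S.eq_empty_or_nonempty with h | h
  · rw [h]; simpa using hpos
  have hmem : ∀ i ∈ S, |i * s - a| ≤ r := fun i hi => by
    simpa [Real.dist_eq] using (Finset.mem_filter.1 hi).2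
  set m := S.min' h with hm
  have hsub : S ⊆ Finset.Icc m (m + ⌊2 * r / |s|⌋₊) := by
    intro i hi
    have hmi : m ≤ i := S.min'_le i hi
    refine Finset.mem_Icc.2 ⟨hmi, ?_⟩
    have h1 := hmem i hi
    have h2 := hmem m (S.min'_mem h)
    have h3 : ((i - m : ℕ) : ℝ) * |s| ≤ 2 * r := by
      rw [Nat.cast_sub hmi, ← abs_of_nonneg (sub_nonneg.2 (Nat.cast_le (α := ℝ).2 hmi)), ← abs_mul]
      calc |((i : ℝ) - m) * s| = |(i * s - a) - (m * s - a)| := by ring_nf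
        _ ≤ |i * s - a| + |m * s - a| := abs_sub _ _
        _ ≤ 2 * r := by linarith
    have h4 : i - m ≤ ⌊2 * r / |s|⌋₊ := Nat.le_floor (by rwa [le_div_iff₀ hs'])
    omega
  have hcard : (S.card : ℝ) ≤ ⌊2 * r / |s|⌋₊ + 1 := by
    have := Finset.card_le_card hsub
    rw [Nat.card_Icc] at this
    have h5 : S.card ≤ ⌊2 * r / |s|⌋₊ + 1 := by omega
    exact_mod_cast h5
  have hfl : (⌊2 * r / |s|⌋₊ : ℝ) ≤ 2 * r / |s| := Nat.floor_le (by positivity)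
  calc (S.card : ℝ) ≤ 2 * r / |s| + r := by linarith
    _ = _ := by ring

theorem one_le_flowMetricSlowEntropy :
    1 ≤ flowMetricSlowEntropy geodesicFlow polyScaleReal unitTangentHaar := by
  refine le_iSup₂_of_le 4 quadrantPartition (le_iSup_of_le measurable_quadrantPartition ?_)
  refine le_limsup_of_frequently_le (Eventually.frequently ?_)
  filter_upwards [Ioc_mem_nhdsGT (show (0 : ℝ) < 1 / 6 by norm_num)] with ε hε
  refine one_le_growthRate_rpow (u := id) (w := fun j => 2 ^ j) (c := 1 / 320) (C := 2)
    (tendsto_pow_atTop_atTop_of_one_lt (by norm_num)) (fun j => rfl) (by norm_num) (by norm_num)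
    fun j => ?_
  have hT : (0 : ℝ) < 2 ^ j := by positivity
  have := isProbabilityMeasure_uniformTime hT
  refine le_iInf₂ fun F hF => ?_
  simp only [flowHammingDist_eq_codeDist geodesicFlow hT measurable_quadrantPartition] at hF
  exact ofReal_le_card_of_hamming_cover (uniformTime (2 ^ j)) (by norm_num)
    (fun s r hr => uniformTime_closedBall_le hT s hr) hε.2 hF

theorem one_le_metricSlowEntropy {s : ℝ} (hs : s ≠ 0) :
    1 ≤ metricSlowEntropy (geodesicFlow s) polyScale unitTangentHaar := by
  refine le_iSup₂_of_le 4 quadrantPartition (le_iSup_of_le measurable_quadrantPartition ?_)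
  refine le_limsup_of_frequently_le (Eventually.frequently ?_)
  filter_upwards [Ioc_mem_nhdsGT (show (0 : ℝ) < 1 / 6 by norm_num)] with ε hε
  refine one_le_growthRate_rpow (u := fun n : ℕ => (n : ℝ)) (w := fun j => 2 ^ j) (c := 1 / 320)
    (C := 2 / |s| + 1) (tendsto_pow_atTop_atTop_of_one_lt (by norm_num)) (fun j => by simp)
    (by norm_num) (by positivity) fun j => ?_
  have hn : 0 < 2 ^ j := by positivity
  have := isProbabilityMeasure_discreteTime s hn
  refine le_iInf₂ fun F hF => ?_
  simp only [hammingDist_eq_codeDist geodesicFlow s hn] at hF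
  refine ofReal_le_card_of_hamming_cover (discreteTime s (2 ^ j)) (by positivity)
    (fun a r hr => ?_) hε.2 hF
  have h := discreteTime_closedBall_le hs hn a hr
  push_cast at h
  exact h

theorem flowMetricSlowEntropy_geodesicFlow :
    flowMetricSlowEntropy geodesicFlow polyScaleReal unitTangentHaar = 1 :=
  le_antisymm ((flowMetricSlowEntropy_le_flowTopSlowEntropy _ _ measurePreserving_geodesicFlow
    _).trans flowTopSlowEntropy_geodesicFlow_le) one_le_flowMetricSlowEntropy

theorem flowTopSlowEntropy_geodesicFlow :
    flowTopSlowEntropy geodesicFlow polyScaleReal = 1 :=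
  le_antisymm flowTopSlowEntropy_geodesicFlow_le (one_le_flowMetricSlowEntropy.trans
    (flowMetricSlowEntropy_le_flowTopSlowEntropy _ _ measurePreserving_geodesicFlow _))

theorem metricSlowEntropy_geodesicFlow {s : ℝ} (hs : s ≠ 0) :
    metricSlowEntropy (geodesicFlow s) polyScale unitTangentHaar = 1 :=
  le_antisymm ((metricSlowEntropy_le_topSlowEntropy _ _ _ (measurePreserving_geodesicFlow s)
    _).trans (topSlowEntropy_geodesicFlow_le s)) (one_le_metricSlowEntropy hs)

theorem topSlowEntropy_geodesicFlow {s : ℝ} (hs : s ≠ 0) :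
    topSlowEntropy (geodesicFlow s) polyScale = 1 :=
  le_antisymm (topSlowEntropy_geodesicFlow_le s) ((one_le_metricSlowEntropy hs).trans
    (metricSlowEntropy_le_topSlowEntropy _ _ _ (measurePreserving_geodesicFlow s) _))


/-! ### Ergodic measures are Kronecker -/

/-- The translations that preserve a finite measure on a metrizable topological group form a
closed set. -/
theorem isClosed_setOf_map_add_eq {G : Type*} [AddGroup G] [TopologicalSpace G]
    [TopologicalSpace.MetrizableSpace G] [IsTopologicalAddGroup G] [MeasurableSpace G]
    [BorelSpace G] [SecondCountableTopology G]
    (ρ : Measure G) [IsFiniteMeasure ρ] : IsClosed {g : G | ρ.map (g + ·) = ρ} := by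
  -- A finite measure is determined by its integrals of bounded continuous functions, and each such
  -- integral depends continuously on the translation by dominated convergence.
  have hset : {g : G | ρ.map (g + ·) = ρ} =
      ⋂ f : BoundedContinuousFunction G ℝ, {g : G | ∫ x, f (g + x) ∂ρ = ∫ x, f x ∂ρ} := by
    ext g
    simp only [mem_iInter, mem_ofPred_eq]
    have hm : AEMeasurable (fun x : G => g + x) ρ := (measurable_const_add g).aemeasurable
    have hmap : ∀ f : BoundedContinuousFunction G ℝ,
        ∫ x, f x ∂(ρ.map (g + ·)) = ∫ x, f (g + x) ∂ρ := fun f =>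
      integral_map hm f.continuous.measurable.aestronglyMeasurable
    constructor
    · intro h f
      rw [← hmap, h]
    · intro h
      refine ext_of_forall_integral_eq_of_IsFiniteMeasure fun f => ?_
      rw [hmap, h]
  rw [hset]
  refine isClosed_iInter fun f => isClosed_eq ?_ continuous_const
  refine continuous_of_dominated (bound := fun _ => ‖f‖) (fun g => ?_) (fun g => ?_)
    (integrable_const _) (Eventually.of_forall fun x => ?_)
  · exact (f.continuous.comp (continuous_const_add g)).measurable.aestronglyMeasurable
  · exact Eventually.of_forall fun x => f.norm_coe_le_norm _
  · exact f.continuous.comp (continuous_add_const x)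

/-- The group of the translations that preserve a measure. -/
def translationStabilizer {G : Type*} [AddGroup G] [MeasurableSpace G] [MeasurableAdd G]
    (ρ : Measure G) : AddSubgroup G where
  carrier := {g : G | ρ.map (g + ·) = ρ}
  zero_mem' := by simp
  add_mem' {g h} hg hh := by
    have hcomp : (fun x => g + h + x) = (fun x => g + x) ∘ fun x => h + x := by
      ext x; simp [add_assoc]
    simp only [mem_ofPred_eq] at hg hh ⊢
    rw [hcomp, ← Measure.map_map (measurable_const_add g) (measurable_const_add h), hh, hg]
  neg_mem' {g} hg := by
    simp only [mem_ofPred_eq] at hg ⊢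
    nth_rw 1 [← hg]
    rw [Measure.map_map (measurable_const_add _) (measurable_const_add _)]
    simp [Function.comp_def]

/-- A measure is ergodic for the times `S` of the geodesic flow. -/
structure IsErgodicOn (S : Set ℝ) (ν : Measure UnitTangentTorus) : Prop where
  prob : IsProbabilityMeasure ν
  measurePreserving : ∀ t ∈ S, MeasurePreserving (geodesicFlow t) ν ν
  ergodic : ∀ A, MeasurableSet A → (∀ t ∈ S, geodesicFlow t ⁻¹' A = A) → ν A = 0 ∨ ν Aᶜ = 0

theorem IsFlowErgodicProb.isErgodicOn {ν : Measure UnitTangentTorus}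
    (h : IsFlowErgodicProb geodesicFlow ν) : IsErgodicOn univ ν :=
  ⟨h.prob, fun t _ => h.measurePreserving t, fun A hA hinv => h.ergodic A hA fun t =>
    hinv t (mem_univ t)⟩

theorem IsErgodicProb.isErgodicOn {s : ℝ} {ν : Measure UnitTangentTorus}
    (h : IsErgodicProb (geodesicFlow s) ν) : IsErgodicOn {s} ν := by
  refine ⟨h.prob, fun t ht => ?_, fun A hA hinv => ?_⟩
  · rw [mem_singleton_iff.1 ht]; exact h.ergodic.toMeasurePreserving
  · rcases h.ergodic.toPreErgodic.ae_empty_or_univ hA (hinv s rfl) with h1 | h1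
    · exact Or.inl (ae_eq_empty.1 h1)
    · exact Or.inr (ae_eq_univ.1 h1)

namespace IsErgodicOn

variable {S : Set ℝ} {ν : Measure UnitTangentTorus}

/-- The direction is an invariant function. Each open set of directions has measure zero or full
measure, and countably many of them separate points. -/
theorem exists_ae_direction_eq (h : IsErgodicOn S ν) : ∃ v : Circle, ∀ᵐ x ∂ν, x.2 = v := by
  refine exists_eventuallyEq_const_of_forall_separating (l := ae ν) IsOpen fun U hU => ?_
  have hA : MeasurableSet {x : UnitTangentTorus | x.2 ∈ U} := measurable_snd hU.measurableSet
  rcases h.ergodic _ hA (fun t _ => rfl) with h1 | h1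
  · exact Or.inr (measure_eq_zero_iff_ae_notMem.1 h1)
  · exact Or.inl h1

/-- On the fibre of `v` the class modulo `H` is invariant under the times `S`, hence almost surely
constant by the same zero-one argument. -/
theorem exists_ae_sub_mem (h : IsErgodicOn S ν) {v : Circle} (hv : ∀ᵐ x ∂ν, x.2 = v)
    (H : AddSubgroup Torus) [IsClosed (H : Set Torus)]
    (hS : ∀ t ∈ S, torusProj (t * (v : ℂ)) ∈ H) : ∃ x₀ : Torus, ∀ᵐ x ∂ν, x.1 - x₀ ∈ H := by
  set q : Torus → Torus ⧸ H := fun p => (p : Torus ⧸ H) with hq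
  have hqc : Continuous q := continuous_quot_mk
  obtain ⟨c, hc⟩ : ∃ c, (fun x : UnitTangentTorus => q x.1) =ᵐ[ν] Function.const _ c := by
    refine exists_eventuallyEq_const_of_forall_separating (l := ae ν) IsOpen fun U hU => ?_
    -- Ergodicity is stated for strictly invariant sets. In other directions the translation need
    -- not lie in `H`, so the condition `x.2 = v` is part of the set.
    set A : Set UnitTangentTorus := {x | x.2 = v ∧ q x.1 ∈ U} with hA
    have hAm : MeasurableSet A := (measurable_snd (measurableSet_singleton v)).inter
      (hU.preimage (hqc.comp continuous_fst)).measurableSet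
    have hinv : ∀ t ∈ S, geodesicFlow t ⁻¹' A = A := by
      intro t ht
      ext x
      simp only [hA, mem_preimage, mem_ofPred_eq, geodesicFlow_apply]
      refine and_congr_right fun hx => ?_
      have : q (x.1 + torusProj (t * (x.2 : ℂ))) = q x.1 := by
        simp only [hq]
        rw [QuotientAddGroup.eq, hx]
        simpa using H.neg_mem (hS t ht)
      rw [this]
    rcases h.ergodic A hAm hinv with h1 | h1
    · refine Or.inr ?_
      filter_upwards [measure_eq_zero_iff_ae_notMem.1 h1, hv] with x hx hxv hxU
      exact hx ⟨hxv, hxU⟩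
    · refine Or.inl ?_
      have h2 : ∀ᵐ x ∂ν, x ∈ A := h1
      filter_upwards [h2] with x hx
      exact hx.2
  obtain ⟨x₀, rfl⟩ := QuotientAddGroup.mk_surjective c
  refine ⟨x₀, hc.mono fun x hx => ?_⟩
  have h1 : (x₀ : Torus ⧸ H) = (x.1 : Torus ⧸ H) := hx.symm
  rw [QuotientAddGroup.eq] at h1
  rwa [sub_eq_neg_add]

/-- The ergodic measures of the geodesic flow, or of its time maps, are isomorphic to the Haar
measures of closed subgroups of the torus. -/
theorem exists_isomorphism (h : IsErgodicOn S ν) {v : Circle} (hv : ∀ᵐ x ∂ν, x.2 = v) :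
    ∃ (H : AddSubgroup Torus) (_ : CompactSpace H) (hS : ∀ t ∈ S, torusProj (t * (v : ℂ)) ∈ H)
      (m : Measure H) (_ : m.IsAddHaarMeasure) (_ : IsProbabilityMeasure m)
      (Φ : UnitTangentTorus → H), IsIsoModZero ν m Φ ∧
        ∀ t (ht : t ∈ S), ∀ᵐ x ∂ν, Φ (geodesicFlow t x) = ⟨_, hS t ht⟩ + Φ x := by
  classical
  have := h.prob
  set D : Set Torus := (fun t : ℝ => torusProj (t * (v : ℂ))) '' S with hD
  set H : AddSubgroup Torus := (AddSubgroup.closure D).topologicalClosure with hH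
  have hHc : IsClosed (H : Set Torus) := AddSubgroup.isClosed_topologicalClosure _
  have hS : ∀ t ∈ S, torusProj (t * (v : ℂ)) ∈ H := fun t ht =>
    AddSubgroup.le_topologicalClosure _ (AddSubgroup.subset_closure ⟨t, ht, rfl⟩)
  have hHcomp : CompactSpace H := isCompact_iff_compactSpace.1 hHc.isCompact
  obtain ⟨x₀, hx₀⟩ := h.exists_ae_sub_mem hv H hS
  -- The projection of the measure to the torus is invariant under `H`.
  set ρ : Measure Torus := ν.map Prod.fst with hρ
  have hρp : IsProbabilityMeasure ρ := Measure.isProbabilityMeasure_map measurable_fst.aemeasurable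
  -- The stabilizer is a closed subgroup containing the generators `D`, hence contains `H`.
  have hstab : H ≤ translationStabilizer ρ := by
    refine AddSubgroup.topologicalClosure_minimal _ ((AddSubgroup.closure_le _).2 ?_)
      (isClosed_setOf_map_add_eq ρ)
    rintro _ ⟨t, ht, rfl⟩
    have hm := h.measurePreserving t ht
    change ρ.map (torusProj (t * (v : ℂ)) + ·) = ρ
    rw [hρ, Measure.map_map (measurable_const_add _) measurable_fst]
    nth_rw 2 [← hm.map_eq]
    rw [Measure.map_map measurable_fst hm.measurable]
    refine Measure.map_congr ?_
    filter_upwards [hv] with x hx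
    simp [geodesicFlow_apply, hx, add_comm]
  -- The value `0` off the coset is immaterial: this happens on a null set.
  set Φ : UnitTangentTorus → H := fun x => if hx : x.1 - x₀ ∈ H then ⟨x.1 - x₀, hx⟩ else 0 with hΦ
  have hΦm : Measurable Φ := by
    have hset : MeasurableSet {x : UnitTangentTorus | x.1 - x₀ ∈ H} :=
      (hHc.preimage (by fun_prop : Continuous fun x : UnitTangentTorus => x.1 - x₀)).measurableSet
    refine Measurable.dite (f := fun x : {x : UnitTangentTorus | x.1 - x₀ ∈ H} =>
      (⟨x.1.1 - x₀, x.2⟩ : H)) (g := fun _ => (0 : H)) ?_ measurable_const hset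
    exact (Continuous.measurable (by fun_prop)).subtype_mk
  set Ψ : H → UnitTangentTorus := fun g => (x₀ + g, v) with hΨ
  have hΨm : Measurable Ψ := Continuous.measurable (by fun_prop)
  have hΨΦ : ∀ᵐ x ∂ν, Ψ (Φ x) = x := by
    filter_upwards [hv, hx₀] with x hx hx'
    simp only [hΨ, hΦ, dif_pos hx']
    ext1
    · simp
    · exact hx.symm
  have hΦΨ : ∀ g, Φ (Ψ g) = g := by
    intro g
    have : (Ψ g).1 - x₀ ∈ H := by simp [hΨ]
    simp only [hΦ, dif_pos this]
    ext1
    simp [hΨ]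
  set m : Measure H := ν.map Φ with hm
  have hmp : IsProbabilityMeasure m := Measure.isProbabilityMeasure_map hΦm.aemeasurable
  have hmΨ : m.map Ψ = ν := by
    rw [hm, Measure.map_map hΨm hΦm, Measure.map_congr (f := Ψ ∘ Φ) (g := id) hΨΦ, Measure.map_id]
  have hι : MeasurableEmbedding fun g : H => x₀ + (g : Torus) :=
    (MeasurableEquiv.addLeft x₀).measurableEmbedding.comp
      (MeasurableEmbedding.subtype_coe hHc.measurableSet)
  have hmι : m.map (fun g : H => x₀ + (g : Torus)) = ρ := by
    rw [hρ, ← hmΨ, Measure.map_map measurable_fst hΨm]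
    rfl
  -- Invariance is tested after embedding `H` as the coset of `x₀`, where `m` becomes `ρ`.
  have hinv : m.IsAddLeftInvariant := by
    refine ⟨fun g => hι.map_injective ?_⟩
    rw [Measure.map_map hι.measurable (measurable_const_add g)]
    have hcomp : (fun k : H => x₀ + (k : Torus)) ∘ (fun k => g + k) =
        (fun p => (g : Torus) + p) ∘ fun k : H => x₀ + (k : Torus) := by
      ext1 k
      simp only [Function.comp, AddSubgroup.coe_add]
      abel
    rw [hcomp, ← Measure.map_map (measurable_const_add _) hι.measurable, hmι]
    exact hstab g.2
  have hhaar : m.IsAddHaarMeasure := Measure.isAddHaarMeasure_of_isCompact_nonempty_interior m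
    univ isCompact_univ (by simp) (by simp) (by simp)
  refine ⟨H, hHcomp, hS, m, hhaar, hmp, Φ, ⟨⟨hΦm, rfl⟩, Ψ, ⟨hΨm, hmΨ⟩, hΨΦ,
    Eventually.of_forall hΦΨ⟩, fun t ht => ?_⟩
  filter_upwards [hv, hx₀] with x hx hx'
  have h1 : (geodesicFlow t x).1 - x₀ = torusProj (t * (v : ℂ)) + (x.1 - x₀) := by
    rw [geodesicFlow_apply, hx, add_comm x.1, add_sub_assoc]
  have h2 : (geodesicFlow t x).1 - x₀ ∈ H := h1 ▸ H.add_mem (hS t ht) hx'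
  simp only [hΦ, dif_pos hx', dif_pos h2]
  ext1
  exact h1

end IsErgodicOn

/-! ### Consequences for ergodic measures -/

theorem IsErgodicProb.isKronecker {s : ℝ} {ν : Measure UnitTangentTorus}
    (h : IsErgodicProb (geodesicFlow s) ν) : IsKronecker (geodesicFlow s) ν := by
  obtain ⟨v, hv⟩ := h.isErgodicOn.exists_ae_direction_eq
  obtain ⟨H, hc, hS, m, hm, hmp, Φ, hΦ, hact⟩ := h.isErgodicOn.exists_isomorphism hv
  exact ⟨H, inferInstance, inferInstance, inferInstance, hc, inferInstance, inferInstance,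
    inferInstance, m, hm, hmp, _, Φ, hΦ, hact s rfl⟩

theorem IsFlowErgodicProb.isKroneckerFlow {ν : Measure UnitTangentTorus}
    (h : IsFlowErgodicProb geodesicFlow ν) : IsKroneckerFlow geodesicFlow ν := by
  obtain ⟨v, hv⟩ := h.isErgodicOn.exists_ae_direction_eq
  obtain ⟨H, hc, hS, m, hm, hmp, Φ, hΦ, hact⟩ := h.isErgodicOn.exists_isomorphism hv
  let α : ℝ →+ H := AddMonoidHom.mk' (fun t => ⟨torusProj (t * (v : ℂ)), hS t (mem_univ t)⟩)
    fun s t => by ext1; simp [add_mul, torusProj_add]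
  have hα : Continuous α := by
    refine Continuous.subtype_mk ?_ _
    unfold torusProj
    exact ((AddCircle.continuous_mk' (1 : ℝ)).comp (by fun_prop)).prodMk
      ((AddCircle.continuous_mk' (1 : ℝ)).comp (by fun_prop))
  exact ⟨H, inferInstance, inferInstance, inferInstance, hc, inferInstance, inferInstance,
    inferInstance, m, hm, hmp, α, hα, Φ, hΦ, fun t => hact t (mem_univ t)⟩

theorem IsErgodicProb.metricSlowEntropy_eq_zero {s : ℝ} {ν : Measure UnitTangentTorus}
    (h : IsErgodicProb (geodesicFlow s) ν) {a : ℝ≥0 → ℕ → ℝ} (ha : IsScale a) :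
    metricSlowEntropy (geodesicFlow s) a ν = 0 := by
  have := h.prob
  obtain ⟨v, hv⟩ := h.isErgodicOn.exists_ae_direction_eq
  exact SlowEntropy.metricSlowEntropy_eq_zero geodesicFlow s ν h.ergodic.toMeasurePreserving hv
    (fun r hr => exists_finset_fiber_cover v hr) ha

/-- The measure need not be ergodic for the time `s` map; invariance and constancy of the direction
are enough. -/
theorem IsFlowErgodicProb.metricSlowEntropy_eq_zero {ν : Measure UnitTangentTorus}
    (h : IsFlowErgodicProb geodesicFlow ν) (s : ℝ) {a : ℝ≥0 → ℕ → ℝ} (ha : IsScale a) :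
    metricSlowEntropy (geodesicFlow s) a ν = 0 := by
  have := h.prob
  obtain ⟨v, hv⟩ := h.isErgodicOn.exists_ae_direction_eq
  exact SlowEntropy.metricSlowEntropy_eq_zero geodesicFlow s ν (h.measurePreserving s) hv
    (fun r hr => exists_finset_fiber_cover v hr) ha

theorem IsFlowErgodicProb.flowMetricSlowEntropy_eq_zero {ν : Measure UnitTangentTorus}
    (h : IsFlowErgodicProb geodesicFlow ν) {a : ℝ≥0 → ℝ → ℝ} (ha : IsScale a) :
    flowMetricSlowEntropy geodesicFlow a ν = 0 := by
  have := h.prob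
  obtain ⟨v, hv⟩ := h.isErgodicOn.exists_ae_direction_eq
  exact SlowEntropy.flowMetricSlowEntropy_eq_zero geodesicFlow ν h.measurePreserving hv
    (fun r hr => exists_finset_fiber_cover v hr) ha


/-! ### Ergodic translations of the torus -/

/-- The characters of the torus. -/
noncomputable def torusChar (n : Fin 2 → ℤ) (p : Torus) : ℂ :=
  (AddCircle.toCircle (n 0 • p.1 + n 1 • p.2) : ℂ)

theorem torusChar_add (n : Fin 2 → ℤ) (p q : Torus) :
    torusChar n (p + q) = torusChar n p * torusChar n q := by
  rw [torusChar, torusChar, torusChar, ← Circle.coe_mul, ← AddCircle.toCircle_add]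
  congr 2
  simp only [Prod.fst_add, Prod.snd_add, smul_add]
  abel

/-- The identification of the torus with the standard torus of dimension two. -/
noncomputable def torusEquiv (p : Torus) : UnitAddTorus (Fin 2) := ![p.1, p.2]

theorem continuous_torusEquiv : Continuous torusEquiv := by
  refine continuous_pi fun i => ?_
  fin_cases i
  · exact continuous_fst
  · exact continuous_snd

theorem mFourier_torusEquiv (n : Fin 2 → ℤ) (p : Torus) :
    UnitAddTorus.mFourier n (torusEquiv p) = torusChar n p := by
  simp [UnitAddTorus.mFourier, torusEquiv, torusChar, fourier_apply, Fin.prod_univ_two,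
    AddCircle.toCircle_add]

theorem measurableEmbedding_torusEquiv : MeasurableEmbedding torusEquiv := by
  refine (Topology.IsClosedEmbedding.measurableEmbedding ?_)
  refine continuous_torusEquiv.isClosedEmbedding fun p q h => ?_
  exact Prod.ext (congrFun h 0) (congrFun h 1)

/-- If no nontrivial character is trivial at `g`, then the translation by `g` is uniquely
ergodic. -/
theorem eq_of_map_add_eq {g : Torus} (hg : ∀ n : Fin 2 → ℤ, n ≠ 0 → torusChar n g ≠ 1)
    {ρ₁ ρ₂ : Measure Torus} [IsProbabilityMeasure ρ₁] [IsProbabilityMeasure ρ₂]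
    (h₁ : ρ₁.map (g + ·) = ρ₁) (h₂ : ρ₂.map (g + ·) = ρ₂) : ρ₁ = ρ₂ := by
  have hcont : ∀ n, Continuous (torusChar n) := fun n => by
    have := (UnitAddTorus.mFourier n).continuous.comp continuous_torusEquiv
    refine this.congr fun p => mFourier_torusEquiv n p
  -- Invariance gives `∫ χ = χ(g) ∫ χ`, so the integral of a nontrivial character vanishes.
  have hchar : ∀ (ρ : Measure Torus) [IsProbabilityMeasure ρ], ρ.map (g + ·) = ρ →
      ∀ n, ∫ p, torusChar n p ∂ρ = if n = 0 then 1 else 0 := by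
    intro ρ _ hρ n
    split_ifs with hn
    · subst hn
      simp [torusChar]
    · have h : ∫ p, torusChar n p ∂ρ = torusChar n g * ∫ p, torusChar n p ∂ρ := by
        nth_rw 1 [← hρ]
        rw [integral_map (measurable_const_add g).aemeasurable
          (hcont n).measurable.aestronglyMeasurable, ← integral_const_mul]
        simp only [torusChar_add]
      have h2 : (1 - torusChar n g) * ∫ p, torusChar n p ∂ρ = 0 := by
        rw [sub_mul, ← h, one_mul, sub_self]
      exact (mul_eq_zero.1 h2).resolve_left (sub_ne_zero.2 (hg n hn).symm)
  have hem := measurableEmbedding_torusEquiv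
  refine hem.map_injective ?_
  have := Measure.isProbabilityMeasure_map (μ := ρ₁) hem.measurable.aemeasurable
  have := Measure.isProbabilityMeasure_map (μ := ρ₂) hem.measurable.aemeasurable
  -- Trigonometric polynomials form a point-separating subalgebra, so the Fourier coefficients
  -- determine the measure.
  refine ext_of_forall_mem_subalgebra_integral_eq_of_polish (𝕜 := ℂ)
    (A := (UnitAddTorus.mFourierSubalgebra (Fin 2)).comap
      (BoundedContinuousFunction.toContinuousMapStarₐ ℂ)) ?_ ?_
  · intro x y hxy
    obtain ⟨_, ⟨f, hf, rfl⟩, hne⟩ := UnitAddTorus.mFourierSubalgebra_separatesPoints hxy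
    refine ⟨_, ⟨f, ?_, rfl⟩, hne⟩
    exact ⟨BoundedContinuousFunction.mkOfCompact f, hf, rfl⟩
  · intro f hf
    have hf' : (f : C(UnitAddTorus (Fin 2), ℂ)) ∈
        Submodule.span ℂ (range UnitAddTorus.mFourier) := by
      rw [← UnitAddTorus.mFourierSubalgebra_coe]
      exact hf
    suffices H : ∀ F ∈ Submodule.span ℂ (range (UnitAddTorus.mFourier (d := Fin 2))),
        ∫ x, F x ∂(ρ₁.map torusEquiv) = ∫ x, F x ∂(ρ₂.map torusEquiv) from H _ hf'
    intro F hF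
    have hint : ∀ (F : C(UnitAddTorus (Fin 2), ℂ)) (μ : Measure (UnitAddTorus (Fin 2)))
        [IsFiniteMeasure μ], Integrable F μ := fun F μ _ =>
      (BoundedContinuousFunction.mkOfCompact F).integrable μ
    induction hF using Submodule.span_induction with
    | mem F hF =>
      obtain ⟨n, rfl⟩ := hF
      rw [hem.integral_map, hem.integral_map]
      simp only [mFourier_torusEquiv, hchar ρ₁ h₁, hchar ρ₂ h₂]
    | zero => simp
    | add F G _ _ hF hG =>
      simp only [ContinuousMap.add_apply]
      rw [integral_add (hint F _) (hint G _), integral_add (hint F _) (hint G _), hF, hG]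
    | smul c F _ hF =>
      simp only [ContinuousMap.smul_apply]
      rw [integral_smul, integral_smul, hF]

/-- Volume conditioned on a nonnull invariant set is again an invariant probability. By unique
ergodicity it is the volume itself, which leaves no mass outside the set. -/
theorem volume_eq_zero_or_of_preimage_add_eq {g : Torus}
    (hg : ∀ n : Fin 2 → ℤ, n ≠ 0 → torusChar n g ≠ 1) {A : Set Torus} (hA : MeasurableSet A)
    (hinv : (g + ·) ⁻¹' A = A) :
    (volume : Measure Torus) A = 0 ∨ (volume : Measure Torus) Aᶜ = 0 := by
  by_cases h0 : (volume : Measure Torus) A = 0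
  · exact Or.inl h0
  have hprob : IsProbabilityMeasure (ProbabilityTheory.cond (volume : Measure Torus) A) :=
    ProbabilityTheory.cond_isProbabilityMeasure h0
  have hcond : (ProbabilityTheory.cond (volume : Measure Torus) A).map (g + ·) =
      ProbabilityTheory.cond (volume : Measure Torus) A := by
    refine Measure.ext fun B hB => ?_
    rw [Measure.map_apply (measurable_const_add g) hB, ProbabilityTheory.cond_apply hA,
      ProbabilityTheory.cond_apply hA]
    congr 1
    nth_rw 1 [← hinv]
    rw [← preimage_inter, measure_preimage_add]
  have h := eq_of_map_add_eq hg hcond (map_add_left_eq_self (volume : Measure Torus) g)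
  right
  rw [← h, ProbabilityTheory.cond_apply hA]
  simp

/-! ### The measures of constant direction -/

theorem measurable_prodMk_direction (v : Circle) :
    Measurable fun p : Torus => ((p, v) : UnitTangentTorus) := by fun_prop

instance (v : Circle) : IsProbabilityMeasure (directionMeasure v) :=
  Measure.isProbabilityMeasure_map (measurable_prodMk_direction v).aemeasurable

theorem directionMeasure_apply (v : Circle) {A : Set UnitTangentTorus} (hA : MeasurableSet A) :
    directionMeasure v A = volume {p : Torus | (p, v) ∈ A} :=
  Measure.map_apply (measurable_prodMk_direction v) hA

theorem measurable_directionMeasure : Measurable directionMeasure := by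
  refine Measure.measurable_of_measurable_coe _ fun A hA => ?_
  simp only [directionMeasure_apply _ hA]
  exact measurable_measure_prodMk_right hA

/-- Needed for the image of a Borel set of directions to be measurable in the space of measures. -/
theorem directionMeasure_injective : Function.Injective directionMeasure := by
  intro v w h
  by_contra hne
  have hA : MeasurableSet {x : UnitTangentTorus | x.2 = v} :=
    measurable_snd (measurableSet_singleton v)
  have h1 := directionMeasure_apply v hA
  rw [h, directionMeasure_apply w hA] at h1
  simp [Ne.symm hne] at h1

theorem measurePreserving_directionMeasure (v : Circle) (t : ℝ) :
    MeasurePreserving (geodesicFlow t) (directionMeasure v) (directionMeasure v) := by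
  have hm : Measurable (geodesicFlow t) := (geodesicFlow.continuous_toFun t).measurable
  refine ⟨hm, Measure.ext fun A hA => ?_⟩
  rw [Measure.map_apply hm hA, directionMeasure_apply v (hm hA), directionMeasure_apply v hA,
    ← measure_preimage_add (volume : Measure Torus) (torusProj (t * (v : ℂ))) {p | (p, v) ∈ A}]
  congr 1
  ext p
  simp [geodesicFlow_apply, add_comm]

/-- The directions in which the time `s` map is a nonresonant translation. -/
def IsNonresonant (s : ℝ) (v : Circle) : Prop :=
  ∀ n : Fin 2 → ℤ, n ≠ 0 → torusChar n (torusProj (s * (v : ℂ))) ≠ 1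

theorem IsNonresonant.isErgodicProb {s : ℝ} {v : Circle} (h : IsNonresonant s v) :
    IsErgodicProb (geodesicFlow s) (directionMeasure v) := by
  refine ⟨inferInstance, measurePreserving_directionMeasure v s, ⟨fun {A} hA hinv => ?_⟩⟩
  have hm : MeasurableSet {p : Torus | (p, v) ∈ A} := measurable_prodMk_direction v hA
  have hinv' : (torusProj (s * (v : ℂ)) + ·) ⁻¹' {p : Torus | (p, v) ∈ A} =
      {p : Torus | (p, v) ∈ A} := by
    ext p
    have : (p, v) ∈ geodesicFlow s ⁻¹' A ↔ (p, v) ∈ A := by rw [hinv]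
    simpa [geodesicFlow_apply, add_comm] using this
  rw [eventuallyConst_set']
  rcases volume_eq_zero_or_of_preimage_add_eq h hm hinv' with h1 | h1
  · left
    rw [ae_eq_empty, directionMeasure_apply v hA, h1]
  · right
    rw [ae_eq_univ, directionMeasure_apply v hA.compl]
    exact h1

theorem IsNonresonant.isFlowErgodicProb {s : ℝ} {v : Circle} (h : IsNonresonant s v) :
    IsFlowErgodicProb geodesicFlow (directionMeasure v) := by
  refine ⟨inferInstance, measurePreserving_directionMeasure v, fun A hA hinv => ?_⟩
  exact h.isErgodicProb.isErgodicOn.ergodic A hA fun t _ => hinv t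

/-- A line meets the circle in at most two points: the coordinate along the line has square `a² + b²
- c²`, and the two coordinates determine the point. -/
theorem finite_setOf_linear_eq {a b : ℝ} (hab : a ≠ 0 ∨ b ≠ 0) (c : ℝ) :
    {v : Circle | a * (v : ℂ).re + b * (v : ℂ).im = c}.Finite := by
  have hN : 0 < a ^ 2 + b ^ 2 := by
    rcases hab with h | h
    · have := sq_pos_of_ne_zero h; positivity
    · have := sq_pos_of_ne_zero h; positivity
  have hcirc : ∀ v : Circle, (v : ℂ).re ^ 2 + (v : ℂ).im ^ 2 = 1 := fun v => by
    have h := Circle.normSq_coe v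
    rw [Complex.normSq_apply] at h
    linarith
  set d : ℝ := √(a ^ 2 + b ^ 2 - c ^ 2) with hd
  refine Set.Finite.of_finite_image (f := fun v : Circle => b * (v : ℂ).re - a * (v : ℂ).im)
    (Set.Finite.subset (Set.toFinite {d, -d}) ?_) ?_
  · rintro _ ⟨v, hv, rfl⟩
    have hv' : a * (v : ℂ).re + b * (v : ℂ).im = c := hv
    have h1 : (b * (v : ℂ).re - a * (v : ℂ).im) ^ 2 = a ^ 2 + b ^ 2 - c ^ 2 := by
      rw [← hv']
      linear_combination (a ^ 2 + b ^ 2) * hcirc v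
    have h2 : 0 ≤ a ^ 2 + b ^ 2 - c ^ 2 := h1 ▸ sq_nonneg _
    rw [← Real.sq_sqrt h2] at h1
    simpa using sq_eq_sq_iff_eq_or_eq_neg.1 h1
  · intro v hv w hw hvw
    have hv' : a * (v : ℂ).re + b * (v : ℂ).im = c := hv
    have hw' : a * (w : ℂ).re + b * (w : ℂ).im = c := hw
    have hvw' : b * (v : ℂ).re - a * (v : ℂ).im = b * (w : ℂ).re - a * (w : ℂ).im := hvw
    refine Circle.ext (Complex.ext ?_ ?_)
    · refine mul_left_cancel₀ hN.ne' ?_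
      linear_combination a * (hv' - hw') + b * hvw'
    · refine mul_left_cancel₀ hN.ne' ?_
      linear_combination b * (hv' - hw') - a * hvw'

theorem torusChar_torusProj_eq_one_iff (n : Fin 2 → ℤ) (z : ℂ) :
    torusChar n (torusProj z) = 1 ↔ ∃ m : ℤ, (m : ℝ) = n 0 * z.re + n 1 * z.im := by
  have h1 : n 0 • (torusProj z).1 + n 1 • (torusProj z).2 =
      ((n 0 * z.re + n 1 * z.im : ℝ) : UnitAddCircle) := by
    simp [torusProj]
  rw [torusChar, h1, show (1 : ℂ) = ((1 : Circle) : ℂ) from rfl, Circle.coe_inj,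
    ← AddCircle.toCircle_zero (T := 1),
    (AddCircle.injective_toCircle one_ne_zero).eq_iff, AddCircle.coe_eq_zero_iff]
  simp

/-- Each resonance, given by a nonzero frequency `n` and an integer `m`, confines the direction to a
line, which is nondegenerate because `s ≠ 0`. -/
theorem countable_not_isNonresonant {s : ℝ} (hs : s ≠ 0) :
    {v : Circle | ¬ IsNonresonant s v}.Countable := by
  have hsub : {v : Circle | ¬ IsNonresonant s v} ⊆ ⋃ n : {n : Fin 2 → ℤ // n ≠ 0}, ⋃ m : ℤ,
      {v : Circle | (n.1 0 * s) * (v : ℂ).re + (n.1 1 * s) * (v : ℂ).im = m} := by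
    intro v hv
    simp only [IsNonresonant, mem_ofPred_eq, not_forall, not_not] at hv
    obtain ⟨n, hn, h⟩ := hv
    obtain ⟨m, hm⟩ := (torusChar_torusProj_eq_one_iff n _).1 h
    refine mem_iUnion.2 ⟨⟨n, hn⟩, mem_iUnion.2 ⟨m, ?_⟩⟩
    rw [Complex.re_ofReal_mul, Complex.im_ofReal_mul] at hm
    simp only [mem_ofPred_eq]
    linarith
  refine Set.Countable.mono hsub (countable_iUnion fun n => countable_iUnion fun m =>
    (finite_setOf_linear_eq ?_ _).countable)
  by_contra! hcon
  refine n.2 (funext fun i => ?_)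
  fin_cases i
  · simpa [hs] using hcon.1
  · simpa [hs] using hcon.2

theorem circleHaar_countable {B : Set Circle} (hB : B.Countable) : circleHaar B = 0 := by
  have hna : NullSingletonClass (volume : Measure UnitAddCircle) := by
    refine ⟨fun x => ?_⟩
    rw [← Metric.closedBall_zero, AddCircle.volume_closedBall]
    simp
  rw [circleHaar_eq_map, Measure.map_apply AddCircle.continuous_toCircle.measurable
    hB.measurableSet]
  exact (hB.preimage (AddCircle.injective_toCircle one_ne_zero)).measure_zero _

/-! ### The ergodic decomposition of the Haar measure -/

/-- The image of a Borel set under an injective measurable family of probability measures is a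
measurable set of measures. -/
theorem exists_measurableSet_subset_image {Y X : Type*} [MeasurableSpace Y] [StandardBorelSpace Y]
    [MeasurableSpace X] [MeasurableSpace.CountablyGenerated X] {κ : Y → Measure X}
    (hκ : Measurable κ) (hinj : Function.Injective κ) [∀ y, IsFiniteMeasure (κ y)] {G : Set Y}
    (hG : MeasurableSet G) : ∃ M : Set (Measure X), MeasurableSet M ∧ M ⊆ κ '' G ∧ κ '' G ⊆ M := by
  set c := generateSetAlgebra (MeasurableSpace.countableGeneratingSet X) with hc
  have hcc : c.Countable :=
    countable_generateSetAlgebra MeasurableSpace.countable_countableGeneratingSet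
  have hgen : MeasurableSpace.generateFrom c = ‹MeasurableSpace X› := by
    rw [hc, generateFrom_generateSetAlgebra_eq,
      MeasurableSpace.generateFrom_countableGeneratingSet]
  have halg : IsSetAlgebra c := isSetAlgebra_generateSetAlgebra
  have hmeas : ∀ A ∈ c, MeasurableSet A := fun A hA =>
    hgen ▸ MeasurableSpace.measurableSet_generateFrom hA
  have : Countable c := hcc.to_subtype
  -- The values on a countable generating algebra determine each `κ y`, and they lie in a countable
  -- product, where the image of a Borel set under an injective Borel map is Borel (Lusin–Souslin).
  set E : Measure X → (c → ℝ≥0∞) := fun ν A => ν A with hE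
  have hEm : Measurable E := measurable_pi_lambda _ fun A => Measure.measurable_coe (hmeas A A.2)
  have hext : ∀ (y : Y) (ν : Measure X), E (κ y) = E ν → κ y = ν := by
    intro y ν h
    refine ext_of_generate_finite c hgen.symm (fun s hs t ht _ => halg.inter_mem hs ht)
      (fun A hA => congrFun h ⟨A, hA⟩) ?_
    exact congrFun h ⟨univ, halg.univ_mem⟩
  have himg : MeasurableSet ((fun y => E (κ y)) '' G) :=
    hG.image_of_measurable_injOn (hEm.comp hκ) fun y _ y' _ h => hinj (hext y _ h)
  refine ⟨E ⁻¹' ((fun y => E (κ y)) '' G), hEm himg, ?_, ?_⟩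
  · rintro ν ⟨y, hy, h⟩
    exact ⟨y, hy, hext y ν h⟩
  · rintro _ ⟨y, hy, rfl⟩
    exact ⟨y, hy, rfl⟩

/-- The barycentre is Fubini. The predicate `erg` is left abstract so that the flow and the time
maps are both covered; for the flow, `s` is auxiliary. -/
theorem isErgodicDecomposition_directionMeasure {erg : Measure UnitTangentTorus → Prop} {s : ℝ}
    (hs : s ≠ 0) (herg : ∀ v, IsNonresonant s v → erg (directionMeasure v)) :
    IsErgodicDecomposition erg unitTangentHaar (circleHaar.map directionMeasure) := by
  refine ⟨Measure.isProbabilityMeasure_map measurable_directionMeasure.aemeasurable, ?_,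
    fun A hA => ?_⟩
  · have hcount := countable_not_isNonresonant hs
    have hG : MeasurableSet {v : Circle | IsNonresonant s v} := by
      have := hcount.measurableSet.compl
      simpa [compl_def] using this
    -- The set of measures satisfying `erg` is not known to be measurable, so the almost sure
    -- statement goes through `M`.
    obtain ⟨M, hM, hMG, hGM⟩ :=
      exists_measurableSet_subset_image measurable_directionMeasure directionMeasure_injective hG
    have hae : ∀ᵐ ν ∂circleHaar.map directionMeasure, ν ∈ M := by
      rw [ae_map_iff (p := (· ∈ M)) measurable_directionMeasure.aemeasurable hM]
      have h0 : ∀ᵐ v ∂circleHaar, IsNonresonant s v := circleHaar_countable hcount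
      filter_upwards [h0] with v hv
      exact hGM ⟨v, hv, rfl⟩
    filter_upwards [hae] with ν hν
    obtain ⟨v, hv, rfl⟩ := hMG hν
    exact herg v hv
  · rw [lintegral_map (Measure.measurable_coe hA) measurable_directionMeasure, unitTangentHaar,
      Measure.prod_apply_symm hA]
    exact lintegral_congr fun v => (directionMeasure_apply v hA).symm

/-! ### The polynomial scale -/

theorem isLittleO_rpow_rpow_atTop {a b : ℝ} (hab : a < b) :
    (fun x : ℝ => x ^ a) =o[atTop] fun x : ℝ => x ^ b := by
  have hpos : ∀ᶠ x : ℝ in atTop, x ^ b ≠ 0 :=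
    (eventually_gt_atTop 0).mono fun x hx => (Real.rpow_pos_of_pos hx b).ne'
  rw [Asymptotics.isLittleO_iff_tendsto' (hpos.mono fun x hx h => absurd h hx)]
  refine (tendsto_rpow_neg_atTop (sub_pos.2 hab)).congr' ?_
  filter_upwards [eventually_gt_atTop 0] with x hx
  rw [neg_sub, Real.rpow_sub hx]

theorem isScale_polyScaleReal : IsScale polyScaleReal where
  pos χ t ht := Real.rpow_pos_of_pos ht _
  mono χ t (ht : 0 < t) t' _ h := Real.rpow_le_rpow ht.le h χ.2
  isLittleO χ χ' h := isLittleO_rpow_rpow_atTop (by exact_mod_cast h)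

theorem isScale_polyScale : IsScale polyScale where
  pos χ n hn := Real.rpow_pos_of_pos (by exact_mod_cast hn) _
  mono χ n _ n' _ h := Real.rpow_le_rpow (by positivity) (by exact_mod_cast h) χ.2
  isLittleO χ χ' h := (isLittleO_rpow_rpow_atTop (by exact_mod_cast h : (χ : ℝ) < χ')).comp_tendsto
    tendsto_natCast_atTop_atTop

end SlowEntropy

/-! ### The theorem -/

theorem mainTheorem11 :
    -- Slow entropy one at polynomial scale: of the flow, and of each of its time maps.
    (SlowEntropy.flowTopSlowEntropy SlowEntropy.geodesicFlow SlowEntropy.polyScaleReal = 1 ∧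
      SlowEntropy.flowMetricSlowEntropy SlowEntropy.geodesicFlow SlowEntropy.polyScaleReal
        SlowEntropy.unitTangentHaar = 1) ∧
    (∀ s : ℝ, s ≠ 0 →
      SlowEntropy.topSlowEntropy (SlowEntropy.geodesicFlow s) SlowEntropy.polyScale = 1 ∧
      SlowEntropy.metricSlowEntropy (SlowEntropy.geodesicFlow s) SlowEntropy.polyScale
        SlowEntropy.unitTangentHaar = 1) ∧
    -- Ergodic measures of the flow are Kronecker, with slow entropy zero at all scales.
    (∀ ν : Measure SlowEntropy.UnitTangentTorus,
      SlowEntropy.IsFlowErgodicProb SlowEntropy.geodesicFlow ν →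
        SlowEntropy.IsKroneckerFlow SlowEntropy.geodesicFlow ν ∧
        (∀ a : ℝ≥0 → ℝ → ℝ, SlowEntropy.IsScale a →
          SlowEntropy.flowMetricSlowEntropy SlowEntropy.geodesicFlow a ν = 0) ∧
        (∀ (s : ℝ) (a : ℝ≥0 → ℕ → ℝ), SlowEntropy.IsScale a →
          SlowEntropy.metricSlowEntropy (SlowEntropy.geodesicFlow s) a ν = 0)) ∧
    -- The same for the ergodic measures of the time maps.
    (∀ (s : ℝ) (ν : Measure SlowEntropy.UnitTangentTorus),
      SlowEntropy.IsErgodicProb (SlowEntropy.geodesicFlow s) ν →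
        SlowEntropy.IsKronecker (SlowEntropy.geodesicFlow s) ν ∧
        (∀ a : ℝ≥0 → ℕ → ℝ, SlowEntropy.IsScale a →
          SlowEntropy.metricSlowEntropy (SlowEntropy.geodesicFlow s) a ν = 0)) ∧
    -- The decomposition into linear flows is an ergodic decomposition of the Haar measure.
    SlowEntropy.IsErgodicDecomposition (SlowEntropy.IsFlowErgodicProb SlowEntropy.geodesicFlow)
      SlowEntropy.unitTangentHaar
      (SlowEntropy.circleHaar.map SlowEntropy.directionMeasure) ∧
    (∀ s : ℝ, s ≠ 0 →
      SlowEntropy.IsErgodicDecomposition (SlowEntropy.IsErgodicProb (SlowEntropy.geodesicFlow s))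
        SlowEntropy.unitTangentHaar
        (SlowEntropy.circleHaar.map SlowEntropy.directionMeasure)) ∧
    -- Slow entropy is not additive over the ergodic decompositions of the Haar measure.
    (∀ P : Measure (Measure SlowEntropy.UnitTangentTorus),
      SlowEntropy.IsErgodicDecomposition (SlowEntropy.IsFlowErgodicProb SlowEntropy.geodesicFlow)
        SlowEntropy.unitTangentHaar P →
      SlowEntropy.flowMetricSlowEntropy SlowEntropy.geodesicFlow SlowEntropy.polyScaleReal
          SlowEntropy.unitTangentHaar ≠
        ∫⁻ ν, SlowEntropy.flowMetricSlowEntropy SlowEntropy.geodesicFlow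
          SlowEntropy.polyScaleReal ν ∂P) ∧
    (∀ s : ℝ, s ≠ 0 → ∀ P : Measure (Measure SlowEntropy.UnitTangentTorus),
      SlowEntropy.IsErgodicDecomposition (SlowEntropy.IsErgodicProb (SlowEntropy.geodesicFlow s))
        SlowEntropy.unitTangentHaar P →
      SlowEntropy.metricSlowEntropy (SlowEntropy.geodesicFlow s) SlowEntropy.polyScale
          SlowEntropy.unitTangentHaar ≠
        ∫⁻ ν, SlowEntropy.metricSlowEntropy (SlowEntropy.geodesicFlow s)
          SlowEntropy.polyScale ν ∂P) := by
  refine ⟨⟨SlowEntropy.flowTopSlowEntropy_geodesicFlow,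
      SlowEntropy.flowMetricSlowEntropy_geodesicFlow⟩,
    fun s hs => ⟨SlowEntropy.topSlowEntropy_geodesicFlow hs,
      SlowEntropy.metricSlowEntropy_geodesicFlow hs⟩,
    fun ν hν => ⟨hν.isKroneckerFlow, fun a ha => hν.flowMetricSlowEntropy_eq_zero ha,
      fun s a ha => hν.metricSlowEntropy_eq_zero s ha⟩,
    fun s ν hν => ⟨hν.isKronecker, fun a ha => hν.metricSlowEntropy_eq_zero ha⟩,
    -- Sets invariant under the flow are invariant under its time-one map, so nonresonance at `s =
    -- 1` suffices for the flow.
    SlowEntropy.isErgodicDecomposition_directionMeasure one_ne_zero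
      fun v hv => hv.isFlowErgodicProb,
    fun s hs => SlowEntropy.isErgodicDecomposition_directionMeasure hs
      fun v hv => hv.isErgodicProb, fun P hP => ?_, fun s hs P hP => ?_⟩
  · have h : ∀ᵐ ν ∂P, SlowEntropy.flowMetricSlowEntropy SlowEntropy.geodesicFlow
        SlowEntropy.polyScaleReal ν = 0 :=
      hP.ergodic.mono fun ν hν =>
        hν.flowMetricSlowEntropy_eq_zero SlowEntropy.isScale_polyScaleReal
    rw [SlowEntropy.flowMetricSlowEntropy_geodesicFlow, lintegral_congr_ae h]
    simp
  · have h : ∀ᵐ ν ∂P, SlowEntropy.metricSlowEntropy (SlowEntropy.geodesicFlow s)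
        SlowEntropy.polyScale ν = 0 :=
      hP.ergodic.mono fun ν hν => hν.metricSlowEntropy_eq_zero SlowEntropy.isScale_polyScale
    rw [SlowEntropy.metricSlowEntropy_geodesicFlow hs, lintegral_congr_ae h]
    simp
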